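/- Let $d\in\{2,3\}$, let $D\subset\mathbb{R}^d$ be a bounded open set (for instance a bounded domain with piecewise smooth boundary), let $A,A_1,\dots,A_M$ be constant real symmetric $d\times d$ matrices, let $z_1,\dots,z_M\in D$ be distinct points and let $B_1,\dots,B_M\subset\mathbb{R}^d$ be bounded measurable sets (for instance smooth deformations of balls centered at the origin). For $\varepsilon>0$ put $A_\varepsilon=A_m$ on $z_m+\varepsilon B_m$ for $m=1,\dots,M$ and $A_\varepsilon=A$ elsewhere; this is well defined whenever the sets $z_m+\varepsilon B_m$ are pairwise disjoint, hence for all small $\varepsilon$. Put $A_0=A$. Write $$A_{\min}=\inf_{|\xi|=1}\overline{\xi}\cdot A\xi,\quad A_{\max}=\sup_{|\xi|=1}\overline{\xi}\cdot A\xi,\quad a_{\min}=\min_m\inf_{|\xi|=1}\overline{\xi}\cdot A_m\xi,\quad a_{\max}=\max_m\sup_{|\xi|=1}\overline{\xi}\cdot A_m\xi ,$$ and assume that either (i) $A_{\min}>1$ and $a_{\min}>1$, in which case let $\gamma=A_{\min}$, or (ii) $A_{\min}>0$, $a_{\min}>0$, $A_{\max}<1$ and $a_{\max}<1$, in which case let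 $\gamma=A_{\max}$ (the conditions on $a_{\min},a_{\max}$ being void if $M=0$). Let $X(D)=\{(w,v)\in H^1(D)\times H^1(D): w-v\in H^1_0(D)\}$ (complex-valued functions) with the inner product of $H^1(D)\times H^1(D)$, and let $\mathbf{A}_\varepsilon:X(D)\to X(D)$ be the bounded operator that represents, by the Riesz theorem, the sesquilinear form $$\mathcal{A}_\varepsilon\big((w,v);(\varphi_1,\varphi_2)\big)=\int_D A_\varepsilon\nabla w\cdot\nabla\overline{\varphi}_1+\gamma\, w\,\overline{\varphi}_1\,dx-\int_D\nabla v\cdot\nabla\overline{\varphi}_2+v\,\overline{\varphi}_2\,dx ,$$ that is, $\big(\mathbf{A}_\varepsilon(w,v),(\varphi_1,\varphi_2)\big)_{X(D)}=\mathcal{A}_\varepsilon\big((w,v);(\varphi_1,\varphi_2)\big)$. Then $\mathbf{A}_0$ is invertible, and $\mathbf{A}_\varepsilon$ is invertible for every $\varepsilon>0$ for which the sets $z_m+\varepsilon B_m$ are pairwise disjoint. Moreover, if $(f,g)\in X(D)$, $(w_\varepsilon,v_\varepsilon)=\mathbf{A}_\varepsilon^{-1}(f,g)$ and $(w,v)=\mathbf{A}_0^{-1}(f,g)$,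 and if $w$ is a smooth ($C^\infty$) function in $D$, then $$\|w_\varepsilon-w\|_{H^1(D)}+\|v_\varepsilon-v\|_{H^1(D)}=\mathcal{O}(\varepsilon^{d/2})\qquad\text{as }\varepsilon\to0^+ .$$ -/

import Mathlib

open MeasureTheory Filter Topology TopologicalSpace
open scoped ENNReal Pointwise ContDiff Distributions InnerProductSpace

noncomputable section

namespace TransmissionDefect

/-! ### Sobolev spaces on an open set `D ⊆ ℝ^d`, complex valued -/

/-- The space `L²(D; ℂ)`. -/
abbrev L2 {d : ℕ} (D : Opens (EuclideanSpace ℝ (Fin d))) : Type :=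
  Lp ℂ 2 (volume.restrict (D : Set (EuclideanSpace ℝ (Fin d))))

/-- The space `L²(D; ℂ^d)` of square integrable vector fields. -/
abbrev L2Vec {d : ℕ} (D : Opens (EuclideanSpace ℝ (Fin d))) : Type :=
  Lp (EuclideanSpace ℂ (Fin d)) 2 (volume.restrict (D : Set (EuclideanSpace ℝ (Fin d))))

/-- `G` is the weak gradient of `u` in `D`:
`∫_D u ∂ᵢφ = - ∫_D Gᵢ φ` for all test functions `φ ∈ C_c^∞(D)` and all `i`. -/
def IsWeakGradient {d : ℕ} (D : Opens (EuclideanSpace ℝ (Fin d))) (u : L2 D) (G : L2Vec D) :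
    Prop :=
  ∀ (φ : 𝓓(D, ℂ)) (i : Fin d),
    ∫ x in (D : Set (EuclideanSpace ℝ (Fin d))),
        u x * fderiv ℝ φ x (EuclideanSpace.single i (1 : ℝ)) =
      - ∫ x in (D : Set (EuclideanSpace ℝ (Fin d))), G x i * φ x

section Aux

variable {d : ℕ} {D : Opens (EuclideanSpace ℝ (Fin d))}

theorem memLp_test (φ : 𝓓(D, ℂ)) :
    MemLp (fun x => φ x) 2 (volume.restrict (D : Set (EuclideanSpace ℝ (Fin d)))) :=
  (φ.continuous.memLp_of_hasCompactSupport φ.hasCompactSupport).restrict _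

theorem memLp_test_fderiv (φ : 𝓓(D, ℂ)) (i : Fin d) :
    MemLp (fun x => fderiv ℝ φ x (EuclideanSpace.single i (1 : ℝ))) 2
      (volume.restrict (D : Set (EuclideanSpace ℝ (Fin d)))) := by
  refine MemLp.restrict _ (Continuous.memLp_of_hasCompactSupport ?_ ?_)
  · exact (φ.contDiff.continuous_fderiv (by simp)).clm_apply continuous_const
  · exact φ.hasCompactSupport.fderiv_apply (𝕜 := ℝ) _

theorem integrable_left (u : L2 D) (φ : 𝓓(D, ℂ)) (i : Fin d) :
    Integrable (fun x => u x * fderiv ℝ φ x (EuclideanSpace.single i (1 : ℝ)))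
      (volume.restrict (D : Set (EuclideanSpace ℝ (Fin d)))) :=
  (Lp.memLp u).integrable_mul (memLp_test_fderiv φ i)

theorem memLp_coord (G : L2Vec D) (i : Fin d) :
    MemLp (fun x => G x i) 2 (volume.restrict (D : Set (EuclideanSpace ℝ (Fin d)))) :=
  (EuclideanSpace.proj (𝕜 := ℂ) i).comp_memLp' (Lp.memLp G)

theorem integrable_right (G : L2Vec D) (φ : 𝓓(D, ℂ)) (i : Fin d) :
    Integrable (fun x => G x i * φ x)
      (volume.restrict (D : Set (EuclideanSpace ℝ (Fin d)))) :=
  (memLp_coord G i).integrable_mul (memLp_test φ)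

theorem continuous_left (φ : 𝓓(D, ℂ)) (i : Fin d) :
    Continuous fun u : L2 D => ∫ x in (D : Set (EuclideanSpace ℝ (Fin d))),
      u x * fderiv ℝ φ x (EuclideanSpace.single i (1 : ℝ)) := by
  have h := (memLp_test_fderiv φ i).star
  have : (fun u : L2 D => ∫ x in (D : Set (EuclideanSpace ℝ (Fin d))),
      u x * fderiv ℝ φ x (EuclideanSpace.single i (1 : ℝ))) = fun u => ⟪h.toLp _, u⟫_ℂ := by
    funext u
    rw [L2.inner_def]
    refine integral_congr_ae ?_
    filter_upwards [h.coeFn_toLp] with x hx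
    simp [hx]
  rw [this]
  fun_prop

theorem continuous_right (φ : 𝓓(D, ℂ)) (i : Fin d) :
    Continuous fun G : L2Vec D => ∫ x in (D : Set (EuclideanSpace ℝ (Fin d))),
      G x i * φ x := by
  have h := (memLp_test φ).star
  have : (fun G : L2Vec D => ∫ x in (D : Set (EuclideanSpace ℝ (Fin d))), G x i * φ x) =
      fun G => ⟪h.toLp _, (EuclideanSpace.proj (𝕜 := ℂ) i).compLp G⟫_ℂ := by
    funext u
    rw [L2.inner_def]
    refine integral_congr_ae ?_
    filter_upwards [h.coeFn_toLp, (EuclideanSpace.proj (𝕜 := ℂ) i).coeFn_compLp u] with x hx hx'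
    simp [hx, hx']
  rw [this]
  have := ((EuclideanSpace.proj (𝕜 := ℂ) i).compLpL 2
    (volume.restrict (D : Set (EuclideanSpace ℝ (Fin d))))).continuous
  exact continuous_const.inner this

end Aux

/-- The Sobolev space `H¹(D)` as a subspace of a product: the pairs `(u, ∇u)` in `L²(D; ℂ) × L²(D; ℂ^d)` whose second
component is the weak gradient of the first one, with the inner product
`(u, v) = ∫_D u v̄ + ∇u · ∇v̄` inherited from the product. -/
def H1Sub {d : ℕ} (D : Opens (EuclideanSpace ℝ (Fin d))) :
    Submodule ℂ (WithLp 2 (L2 D × L2Vec D)) where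
  carrier := {U | IsWeakGradient D U.fst U.snd}
  zero_mem' := by
    intro φ i
    have h1 : (fun x => ((0 : L2 D) x) * fderiv ℝ φ x (EuclideanSpace.single i (1 : ℝ)))
        =ᵐ[volume.restrict (D : Set (EuclideanSpace ℝ (Fin d)))] fun _ => 0 := by
      filter_upwards [Lp.coeFn_zero ℂ 2
        (volume.restrict (D : Set (EuclideanSpace ℝ (Fin d))))] with x hx
      rw [hx]
      simp
    have h2 : (fun x => ((0 : L2Vec D) x) i * φ x)
        =ᵐ[volume.restrict (D : Set (EuclideanSpace ℝ (Fin d)))] fun _ => 0 := by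
      filter_upwards [Lp.coeFn_zero (EuclideanSpace ℂ (Fin d)) 2
        (volume.restrict (D : Set (EuclideanSpace ℝ (Fin d))))] with x hx
      rw [hx]
      simp
    simp only [WithLp.zero_fst, WithLp.zero_snd]
    rw [integral_congr_ae h1, integral_congr_ae h2]
    simp
  add_mem' := by
    intro U V hU hV φ i
    have h1 : (fun x => ((U.fst + V.fst : L2 D) x) *
          fderiv ℝ φ x (EuclideanSpace.single i (1 : ℝ)))
        =ᵐ[volume.restrict (D : Set (EuclideanSpace ℝ (Fin d)))]
        fun x => U.fst x * fderiv ℝ φ x (EuclideanSpace.single i (1 : ℝ)) +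
          V.fst x * fderiv ℝ φ x (EuclideanSpace.single i (1 : ℝ)) := by
      filter_upwards [Lp.coeFn_add U.fst V.fst] with x hx
      rw [hx]
      simp [add_mul]
    have h2 : (fun x => ((U.snd + V.snd : L2Vec D) x) i * φ x)
        =ᵐ[volume.restrict (D : Set (EuclideanSpace ℝ (Fin d)))]
        fun x => U.snd x i * φ x + V.snd x i * φ x := by
      filter_upwards [Lp.coeFn_add U.snd V.snd] with x hx
      rw [hx]
      simp [add_mul]
    simp only [WithLp.add_fst, WithLp.add_snd]
    rw [integral_congr_ae h1, integral_congr_ae h2,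
      integral_add (integrable_left _ φ i) (integrable_left _ φ i),
      integral_add (integrable_right _ φ i) (integrable_right _ φ i), hU φ i, hV φ i]
    ring
  smul_mem' := by
    intro c U hU φ i
    have h1 : (fun x => ((c • U.fst : L2 D) x) *
          fderiv ℝ φ x (EuclideanSpace.single i (1 : ℝ)))
        =ᵐ[volume.restrict (D : Set (EuclideanSpace ℝ (Fin d)))]
        fun x => c * (U.fst x * fderiv ℝ φ x (EuclideanSpace.single i (1 : ℝ))) := by
      filter_upwards [Lp.coeFn_smul c U.fst] with x hx
      rw [hx]
      simp [mul_assoc]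
    have h2 : (fun x => ((c • U.snd : L2Vec D) x) i * φ x)
        =ᵐ[volume.restrict (D : Set (EuclideanSpace ℝ (Fin d)))]
        fun x => c * (U.snd x i * φ x) := by
      filter_upwards [Lp.coeFn_smul c U.snd] with x hx
      rw [hx]
      simp [mul_assoc]
    simp only [WithLp.smul_fst, WithLp.smul_snd]
    rw [integral_congr_ae h1, integral_congr_ae h2, integral_const_mul, integral_const_mul,
      hU φ i]
    ring

theorem isClosed_H1Sub {d : ℕ} (D : Opens (EuclideanSpace ℝ (Fin d))) :
    IsClosed (H1Sub D : Set (WithLp 2 (L2 D × L2Vec D))) := by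
  have : (H1Sub D : Set (WithLp 2 (L2 D × L2Vec D))) = ⋂ (φ : 𝓓(D, ℂ)) (i : Fin d),
      {U | ∫ x in (D : Set (EuclideanSpace ℝ (Fin d))),
          U.fst x * fderiv ℝ φ x (EuclideanSpace.single i (1 : ℝ)) =
        - ∫ x in (D : Set (EuclideanSpace ℝ (Fin d))), U.snd x i * φ x} := by
    ext U
    simp only [Set.mem_iInter, Set.mem_ofPred_eq]
    rfl
  rw [this]
  refine isClosed_iInter fun φ => isClosed_iInter fun i => ?_
  refine isClosed_eq ?_ ?_
  · exact (continuous_left φ i).comp (WithLp.fstL 2 ℂ (L2 D) (L2Vec D)).continuous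
  · exact ((continuous_right φ i).comp (WithLp.sndL 2 ℂ (L2 D) (L2Vec D)).continuous).neg

/-- The Hilbert space `H¹(D)`. -/
def H1 {d : ℕ} (D : Opens (EuclideanSpace ℝ (Fin d))) : Type := H1Sub D

instance {d : ℕ} (D : Opens (EuclideanSpace ℝ (Fin d))) : NormedAddCommGroup (H1 D) :=
  inferInstanceAs (NormedAddCommGroup (H1Sub D))

instance {d : ℕ} (D : Opens (EuclideanSpace ℝ (Fin d))) : InnerProductSpace ℂ (H1 D) :=
  inferInstanceAs (InnerProductSpace ℂ (H1Sub D))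

instance {d : ℕ} (D : Opens (EuclideanSpace ℝ (Fin d))) : CompleteSpace (H1 D) :=
  (isClosed_H1Sub D).completeSpace_coe

/-- The inclusion of `H¹(D)` into `L²(D; ℂ) × L²(D; ℂ^d)`, `u ↦ (u, ∇u)`. -/
def H1.incl {d : ℕ} (D : Opens (EuclideanSpace ℝ (Fin d))) :
    H1 D →L[ℂ] WithLp 2 (L2 D × L2Vec D) :=
  (H1Sub D).subtypeL

/-- The function underlying an element of `H¹(D)`, as a bounded linear map into `L²(D)`. -/
def fn {d : ℕ} (D : Opens (EuclideanSpace ℝ (Fin d))) : H1 D →L[ℂ] L2 D :=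
  (WithLp.fstL 2 ℂ (L2 D) (L2Vec D)).comp (H1.incl D)

/-- The weak gradient on `H¹(D)`, as a bounded linear map into `L²(D; ℂ^d)`. -/
def grad {d : ℕ} (D : Opens (EuclideanSpace ℝ (Fin d))) : H1 D →L[ℂ] L2Vec D :=
  (WithLp.sndL 2 ℂ (L2 D) (L2Vec D)).comp (H1.incl D)

/-- The elements of `H¹(D)` that are represented by a test function in `C_c^∞(D)`. -/
def testSubmodule {d : ℕ} (D : Opens (EuclideanSpace ℝ (Fin d))) : Submodule ℂ (H1 D) where
  carrier := {u | ∃ φ : 𝓓(D, ℂ),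
    (fn D u : EuclideanSpace ℝ (Fin d) → ℂ)
      =ᵐ[volume.restrict (D : Set (EuclideanSpace ℝ (Fin d)))] φ}
  zero_mem' := by
    refine ⟨0, ?_⟩
    rw [map_zero]
    filter_upwards [Lp.coeFn_zero ℂ 2
      (volume.restrict (D : Set (EuclideanSpace ℝ (Fin d))))] with x hx
    rw [hx]
    simp
  add_mem' := by
    rintro u v ⟨φ, hφ⟩ ⟨ψ, hψ⟩
    refine ⟨φ + ψ, ?_⟩
    rw [map_add]
    filter_upwards [Lp.coeFn_add (fn D u) (fn D v), hφ, hψ] with x hx h1 h2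
    rw [hx, Pi.add_apply, h1, h2]
    simp
  smul_mem' := by
    rintro c u ⟨φ, hφ⟩
    refine ⟨c • φ, ?_⟩
    rw [map_smul]
    filter_upwards [Lp.coeFn_smul c (fn D u), hφ] with x hx h1
    rw [hx, Pi.smul_apply, h1]
    simp

/-- The space `H¹₀(D)`, the closure of `C_c^∞(D)` in `H¹(D)`. -/
def H10 {d : ℕ} (D : Opens (EuclideanSpace ℝ (Fin d))) : Submodule ℂ (H1 D) :=
  (testSubmodule D).topologicalClosure

/-- The subspace `X(D) = {(w, v) ∈ H¹(D) × H¹(D) : w - v ∈ H¹₀(D)}` with the inner product of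
`H¹(D) × H¹(D)`. -/
def XSub {d : ℕ} (D : Opens (EuclideanSpace ℝ (Fin d))) :
    Submodule ℂ (WithLp 2 (H1 D × H1 D)) where
  carrier := {U | U.fst - U.snd ∈ H10 D}
  zero_mem' := by simp
  add_mem' := by
    intro U V hU hV
    have := (H10 D).add_mem hU hV
    simp only [Set.mem_ofPred_eq, WithLp.add_fst, WithLp.add_snd]
    rwa [add_sub_add_comm]
  smul_mem' := by
    intro c U hU
    have := (H10 D).smul_mem c hU
    simp only [Set.mem_ofPred_eq, WithLp.smul_fst, WithLp.smul_snd]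
    rwa [← smul_sub]

theorem isClosed_XSub {d : ℕ} (D : Opens (EuclideanSpace ℝ (Fin d))) :
    IsClosed (XSub D : Set (WithLp 2 (H1 D × H1 D))) := by
  have h : IsClosed (H10 D : Set (H1 D)) := (testSubmodule D).isClosed_topologicalClosure
  exact h.preimage (((WithLp.fstL 2 ℂ (H1 D) (H1 D)).continuous).sub
    ((WithLp.sndL 2 ℂ (H1 D) (H1 D)).continuous))

/-- The Hilbert space `X(D)`. -/
def X {d : ℕ} (D : Opens (EuclideanSpace ℝ (Fin d))) : Type := XSub D

instance {d : ℕ} (D : Opens (EuclideanSpace ℝ (Fin d))) : NormedAddCommGroup (X D) :=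
  inferInstanceAs (NormedAddCommGroup (XSub D))

instance {d : ℕ} (D : Opens (EuclideanSpace ℝ (Fin d))) : InnerProductSpace ℂ (X D) :=
  inferInstanceAs (InnerProductSpace ℂ (XSub D))

instance {d : ℕ} (D : Opens (EuclideanSpace ℝ (Fin d))) : CompleteSpace (X D) :=
  (isClosed_XSub D).completeSpace_coe

/-- The inclusion of `X(D)` into `H¹(D) × H¹(D)`. -/
def X.incl {d : ℕ} (D : Opens (EuclideanSpace ℝ (Fin d))) : X D →L[ℂ] WithLp 2 (H1 D × H1 D) :=
  (XSub D).subtypeL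

/-- The first component `w` of `(w, v) ∈ X(D)`. -/
def wPart {d : ℕ} (D : Opens (EuclideanSpace ℝ (Fin d))) : X D →L[ℂ] H1 D :=
  (WithLp.fstL 2 ℂ (H1 D) (H1 D)).comp (X.incl D)

/-- The second component `v` of `(w, v) ∈ X(D)`. -/
def vPart {d : ℕ} (D : Opens (EuclideanSpace ℝ (Fin d))) : X D →L[ℂ] H1 D :=
  (WithLp.sndL 2 ℂ (H1 D) (H1 D)).comp (X.incl D)

/-! ### Coefficients -/

/-- The action of a real `d × d` matrix on `ℂ^d`. -/
def matAct {d : ℕ} (a : Matrix (Fin d) (Fin d) ℝ) :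
    EuclideanSpace ℂ (Fin d) →L[ℂ] EuclideanSpace ℂ (Fin d) :=
  Matrix.toEuclideanCLM (n := Fin d) (𝕜 := ℂ) (a.map (fun t : ℝ => (t : ℂ)))

/-- `inf_{|ξ| = 1} ξ̄ · a ξ` over complex unit vectors `ξ` (a real number if `a` is symmetric). -/
def quadMin {d : ℕ} (a : Matrix (Fin d) (Fin d) ℝ) : ℝ :=
  ⨅ ξ : Metric.sphere (0 : EuclideanSpace ℂ (Fin d)) 1,
    (⟪(ξ : EuclideanSpace ℂ (Fin d)), matAct a ξ⟫_ℂ).re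

/-- `sup_{|ξ| = 1} ξ̄ · a ξ` over complex unit vectors `ξ` (a real number if `a` is symmetric). -/
def quadMax {d : ℕ} (a : Matrix (Fin d) (Fin d) ℝ) : ℝ :=
  ⨆ ξ : Metric.sphere (0 : EuclideanSpace ℂ (Fin d)) 1,
    (⟪(ξ : EuclideanSpace ℂ (Fin d)), matAct a ξ⟫_ℂ).re

/-- Bounded measurable real matrix fields on `ℝ^d`. -/
structure Coeff (d : ℕ) where
  toFun : EuclideanSpace ℝ (Fin d) → Matrix (Fin d) (Fin d) ℝ
  measurable_entry : ∀ i j, Measurable fun x => toFun x i j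
  bounded_entry : ∃ C : ℝ, ∀ x i j, |toFun x i j| ≤ C

/-- The constant matrix field `A`. -/
def constCoeff {d : ℕ} (A : Matrix (Fin d) (Fin d) ℝ) : Coeff d where
  toFun := fun _ => A
  measurable_entry := fun _ _ => measurable_const
  bounded_entry := by
    refine ⟨∑ i, ∑ j, |A i j|, fun _ i j => ?_⟩
    exact (Finset.single_le_sum (f := fun j => |A i j|) (fun _ _ => abs_nonneg _)
      (Finset.mem_univ j)).trans (Finset.single_le_sum (f := fun i => ∑ j, |A i j|)
      (fun _ _ => Finset.sum_nonneg fun _ _ => abs_nonneg _) (Finset.mem_univ i))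

/-- The defective region `z + ε B`. -/
def region {d : ℕ} (z : EuclideanSpace ℝ (Fin d)) (B : Set (EuclideanSpace ℝ (Fin d))) (ε : ℝ) :
    Set (EuclideanSpace ℝ (Fin d)) :=
  (fun y => z + ε • y) '' B

theorem measurableSet_region {d : ℕ} (z : EuclideanSpace ℝ (Fin d))
    {B : Set (EuclideanSpace ℝ (Fin d))} (hB : MeasurableSet B) (ε : ℝ) :
    MeasurableSet (region z B ε) := by
  rcases eq_or_ne ε 0 with rfl | hε
  · refine Set.Subsingleton.measurableSet ?_
    rintro _ ⟨x, _, rfl⟩ _ ⟨y, _, rfl⟩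
    simp
  · exact ((Homeomorph.smulOfNeZero ε hε).trans
      (Homeomorph.addLeft z)).measurableEmbedding.measurableSet_image' hB

open Classical in
/-- The perturbed matrix field `A_ε`, written as `A + ∑ₘ 1_{zₘ + ε Bₘ} (Aₘ - A)`. When the regions
`zₘ + ε Bₘ` are pairwise disjoint, it equals `Aₘ` on `zₘ + ε Bₘ` and `A` elsewhere. -/
def defectCoeff {d M : ℕ} (A : Matrix (Fin d) (Fin d) ℝ)
    (Am : Fin M → Matrix (Fin d) (Fin d) ℝ) (z : Fin M → EuclideanSpace ℝ (Fin d))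
    (B : Fin M → Set (EuclideanSpace ℝ (Fin d))) (hB : ∀ m, MeasurableSet (B m)) (ε : ℝ) :
    Coeff d where
  toFun := fun x => A + ∑ m, if x ∈ region (z m) (B m) ε then Am m - A else 0
  measurable_entry := by
    intro i j
    simp only [Matrix.add_apply, Matrix.sum_apply]
    refine measurable_const.add (Finset.measurable_fun_sum _ fun m _ => ?_)
    simp only [apply_ite (fun a : Matrix (Fin d) (Fin d) ℝ => a i j)]
    exact Measurable.ite (measurableSet_region _ (hB m) ε) measurable_const measurable_const
  bounded_entry := by
    refine ⟨(∑ i, ∑ j, |A i j|) + ∑ m, ∑ i, ∑ j, |(Am m - A) i j|, fun x i j => ?_⟩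
    have key : ∀ a : Matrix (Fin d) (Fin d) ℝ, |a i j| ≤ ∑ i, ∑ j, |a i j| := fun a =>
      (Finset.single_le_sum (f := fun j => |a i j|) (fun _ _ => abs_nonneg _)
        (Finset.mem_univ j)).trans (Finset.single_le_sum (f := fun i => ∑ j, |a i j|)
        (fun _ _ => Finset.sum_nonneg fun _ _ => abs_nonneg _) (Finset.mem_univ i))
    simp only [Matrix.add_apply, Matrix.sum_apply]
    refine (abs_add_le _ _).trans (add_le_add (key A) ?_)
    refine (Finset.abs_sum_le_sum_abs _ _).trans (Finset.sum_le_sum fun m _ => ?_)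
    split_ifs
    · exact key _
    · simpa using Finset.sum_nonneg fun i _ => Finset.sum_nonneg fun j _ => abs_nonneg _

theorem defectCoeff_of_mem {d M : ℕ} (A : Matrix (Fin d) (Fin d) ℝ)
    (Am : Fin M → Matrix (Fin d) (Fin d) ℝ) (z : Fin M → EuclideanSpace ℝ (Fin d))
    (B : Fin M → Set (EuclideanSpace ℝ (Fin d))) (hB : ∀ m, MeasurableSet (B m)) (ε : ℝ)
    (hd : Pairwise fun i j => Disjoint (region (z i) (B i) ε) (region (z j) (B j) ε))
    (m : Fin M) {x : EuclideanSpace ℝ (Fin d)} (hx : x ∈ region (z m) (B m) ε) :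
    (defectCoeff A Am z B hB ε).toFun x = Am m := by
  have : ∀ k, k ≠ m → x ∉ region (z k) (B k) ε := fun k hk hx' =>
    Set.disjoint_left.1 (hd hk) hx' hx
  simp only [defectCoeff]
  rw [Finset.sum_eq_single m (fun k _ hk => if_neg (this k hk)) (by simp), if_pos hx]
  abel

theorem defectCoeff_of_notMem {d M : ℕ} (A : Matrix (Fin d) (Fin d) ℝ)
    (Am : Fin M → Matrix (Fin d) (Fin d) ℝ) (z : Fin M → EuclideanSpace ℝ (Fin d))
    (B : Fin M → Set (EuclideanSpace ℝ (Fin d))) (hB : ∀ m, MeasurableSet (B m)) (ε : ℝ)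
    {x : EuclideanSpace ℝ (Fin d)} (hx : ∀ m, x ∉ region (z m) (B m) ε) :
    (defectCoeff A Am z B hB ε).toFun x = A := by
  simp [defectCoeff, hx]

/-! ### The sesquilinear form and its operator -/

/-- The sesquilinear form
`𝒜((w, v); (φ₁, φ₂)) = ∫_D a ∇w · ∇φ̄₁ + γ w φ̄₁ dx - ∫_D ∇v · ∇φ̄₂ + v φ̄₂ dx`. -/
def form {d : ℕ} (D : Opens (EuclideanSpace ℝ (Fin d))) (a : Coeff d) (γ : ℝ) (U Φ : X D) : ℂ :=
  (∫ x in (D : Set (EuclideanSpace ℝ (Fin d))),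
      (⟪grad D (wPart D Φ) x, matAct (a.toFun x) (grad D (wPart D U) x)⟫_ℂ
        + (γ : ℂ) * ⟪fn D (wPart D Φ) x, fn D (wPart D U) x⟫_ℂ))
  - ∫ x in (D : Set (EuclideanSpace ℝ (Fin d))),
      (⟪grad D (vPart D Φ) x, grad D (vPart D U) x⟫_ℂ
        + ⟪fn D (vPart D Φ) x, fn D (vPart D U) x⟫_ℂ)

theorem matAct_eq_sum {d : ℕ} (a : Matrix (Fin d) (Fin d) ℝ) (ξ : EuclideanSpace ℂ (Fin d)) :
    matAct a ξ = ∑ i, ∑ j, (a i j : ℂ) • matAct (Matrix.single i j 1) ξ := by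
  ext k
  simp only [matAct, WithLp.ofLp_sum, WithLp.ofLp_smul, Matrix.ofLp_toEuclideanCLM,
    Finset.sum_apply, Pi.smul_apply]
  rw [Finset.sum_eq_single k]
  · simp only [Matrix.mulVec, dotProduct, Matrix.map_apply, smul_eq_mul]
    refine Finset.sum_congr rfl fun j _ => ?_
    rw [Finset.sum_eq_single j]
    · simp
    · intro b _ hb
      simp [hb.symm]
    · simp
  · intro i _ hi
    simp [Matrix.mulVec, dotProduct, hi]
  · simp

theorem exists_coeffMul {d : ℕ} (D : Opens (EuclideanSpace ℝ (Fin d))) (a : Coeff d) :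
    ∃ T : L2Vec D →L[ℂ] L2Vec D, ∀ G : L2Vec D,
      (T G : EuclideanSpace ℝ (Fin d) → EuclideanSpace ℂ (Fin d))
        =ᵐ[volume.restrict (D : Set (EuclideanSpace ℝ (Fin d)))]
          fun x => matAct (a.toFun x) (G x) := by
  obtain ⟨C, hC⟩ := a.bounded_entry
  set K : ℝ := ∑ i, ∑ j, C * ‖matAct (Matrix.single i j (1 : ℝ) : Matrix (Fin d) (Fin d) ℝ)‖
    with hK
  have hb : ∀ x (ξ : EuclideanSpace ℂ (Fin d)), ‖matAct (a.toFun x) ξ‖ ≤ K * ‖ξ‖ := by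
    intro x ξ
    rw [matAct_eq_sum, hK, Finset.sum_mul]
    refine (norm_sum_le _ _).trans (Finset.sum_le_sum fun i _ => ?_)
    rw [Finset.sum_mul]
    refine (norm_sum_le _ _).trans (Finset.sum_le_sum fun j _ => ?_)
    rw [norm_smul, mul_assoc]
    refine mul_le_mul ?_ (ContinuousLinearMap.le_opNorm _ _) (norm_nonneg _)
      ((abs_nonneg _).trans (hC x i j))
    simpa using hC x i j
  have hm : ∀ G : L2Vec D, AEStronglyMeasurable (fun x => matAct (a.toFun x) (G x))
      (volume.restrict (D : Set (EuclideanSpace ℝ (Fin d)))) := by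
    intro G
    have : (fun x => matAct (a.toFun x) (G x)) = fun x =>
        ∑ i, ∑ j, ((a.toFun x i j : ℝ) : ℂ) • matAct (Matrix.single i j 1) (G x) := by
      funext x
      exact matAct_eq_sum _ _
    rw [this]
    refine Finset.aestronglyMeasurable_fun_sum _ fun i _ =>
      Finset.aestronglyMeasurable_fun_sum _ fun j _ => ?_
    have h1 : AEStronglyMeasurable (fun x => ((a.toFun x i j : ℝ) : ℂ))
        (volume.restrict (D : Set (EuclideanSpace ℝ (Fin d)))) :=
      (Complex.measurable_ofReal.comp (a.measurable_entry i j)).aestronglyMeasurable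
    exact h1.smul ((matAct (Matrix.single i j 1)).continuous.comp_aestronglyMeasurable
      (Lp.memLp G).1)
  have hL : ∀ G : L2Vec D, MemLp (fun x => matAct (a.toFun x) (G x)) 2
      (volume.restrict (D : Set (EuclideanSpace ℝ (Fin d)))) := fun G =>
    (Lp.memLp G).of_le_mul (hm G) (Eventually.of_forall fun x => hb x _)
  let T₀ : L2Vec D →ₗ[ℂ] L2Vec D :=
    { toFun := fun G => (hL G).toLp _
      map_add' := by
        intro G H
        ext1
        filter_upwards [(hL (G + H)).coeFn_toLp, (hL G).coeFn_toLp, (hL H).coeFn_toLp,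
          Lp.coeFn_add G H, Lp.coeFn_add ((hL G).toLp _) ((hL H).toLp _)] with x h1 h2 h3 h4 h5
        rw [h1, h5, Pi.add_apply, h2, h3, h4, Pi.add_apply, map_add]
      map_smul' := by
        intro c G
        ext1
        filter_upwards [(hL (c • G)).coeFn_toLp, (hL G).coeFn_toLp,
          Lp.coeFn_smul c G, Lp.coeFn_smul c ((hL G).toLp _)] with x h1 h2 h3 h4
        simp only [RingHom.id_apply]
        rw [h1, h4, Pi.smul_apply, h2, h3, Pi.smul_apply, map_smul] }
  have hbd : ∀ G, ‖T₀ G‖ ≤ K * ‖G‖ := by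
    intro G
    refine Lp.norm_le_mul_norm_of_ae_le_mul ?_
    filter_upwards [(hL G).coeFn_toLp] with x hx
    change ‖((hL G).toLp _ : L2Vec D) x‖ ≤ _
    rw [hx]
    exact hb x _
  exact ⟨T₀.mkContinuous K hbd, fun G => (hL G).coeFn_toLp⟩

/-- The sesquilinear form is represented by a unique bounded operator on `X(D)`. -/
theorem existsUnique_op {d : ℕ} (D : Opens (EuclideanSpace ℝ (Fin d))) (a : Coeff d) (γ : ℝ) :
    ∃! T : X D →L[ℂ] X D, ∀ U Φ : X D, ⟪Φ, T U⟫_ℂ = form D a γ U Φ := by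
  obtain ⟨S, hS⟩ := exists_coeffMul D a
  let gw := (grad D).comp (wPart D)
  let fw := (fn D).comp (wPart D)
  let gv := (grad D).comp (vPart D)
  let fv := (fn D).comp (vPart D)
  have key : ∀ U Φ : X D, ⟪Φ, ((gw.adjoint.comp (S.comp gw) + (γ : ℂ) • fw.adjoint.comp fw)
      - (gv.adjoint.comp gv + fv.adjoint.comp fv)) U⟫_ℂ = form D a γ U Φ := by
    intro U Φ
    simp only [sub_apply, add_apply, smul_apply,
      ContinuousLinearMap.comp_apply, inner_sub_right, inner_add_right, inner_smul_right,
      ContinuousLinearMap.adjoint_inner_right]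
    rw [form, integral_add, integral_add, integral_const_mul]
    · simp only [L2.inner_def]
      congr 2
      refine integral_congr_ae ?_
      filter_upwards [hS (gw U)] with x hx
      exact congrArg (fun y => ⟪gw Φ x, y⟫_ℂ) hx
    · exact L2.integrable_inner (𝕜 := ℂ) (gv Φ) (gv U)
    · exact L2.integrable_inner (𝕜 := ℂ) (fv Φ) (fv U)
    · refine (L2.integrable_inner (𝕜 := ℂ) (gw Φ) (S (gw U))).congr ?_
      filter_upwards [hS (gw U)] with x hx
      exact congrArg (fun y => ⟪gw Φ x, y⟫_ℂ) hx
    · exact (L2.integrable_inner (𝕜 := ℂ) (fw Φ) (fw U)).const_mul _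
  refine ⟨_, key, fun T' hT' => ?_⟩
  ext1 U
  exact ext_inner_left ℂ fun Φ => (hT' U Φ).trans (key U Φ).symm

/-- The bounded operator `𝐀 : X(D) → X(D)` with `(𝐀 U, Φ)_{X(D)} = 𝒜(U; Φ)` for all `U, Φ`.
(Mathlib's inner product is antilinear in its first argument.) -/
def op {d : ℕ} (D : Opens (EuclideanSpace ℝ (Fin d))) (a : Coeff d) (γ : ℝ) : X D →L[ℂ] X D :=
  (existsUnique_op D a γ).choose

theorem inner_op {d : ℕ} (D : Opens (EuclideanSpace ℝ (Fin d))) (a : Coeff d) (γ : ℝ)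
    (U Φ : X D) : ⟪Φ, op D a γ U⟫_ℂ = form D a γ U Φ :=
  (existsUnique_op D a γ).choose_spec.1 U Φ

end TransmissionDefect

end

noncomputable section

namespace TransmissionDefect

/-! ### Quadratic forms of real symmetric matrices -/

section Matrices

variable {d : ℕ}

/-! The form is not coercive, because the `v` part enters with a minus sign, but it is `T`-coercive:
for each `U = (w, v)` there is a test pair `V` in `X(D)` with `‖V‖ ≤ 3‖U‖` and `Re 𝒜(U; V) ≥ c‖U‖²`.
When all coefficients exceed 1, `V = (w, 2w − v)` works, since the `w` energy dominates `‖w‖²` with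
a factor above 1 (`bound_of_one_lt`). When they lie strictly between 0 and 1, `V = (w − 2v, −v)`
works, since the cross term is absorbed by a Cauchy–Schwarz inequality in the energy of the
coefficient (`bound_of_lt_one`). Hence `c‖U‖ ≤ ‖𝐀U‖`, and since the operator is symmetric this alone
gives invertibility (`isInvertible_of_symmetric_of_bound`). The constant `c` depends only on the
finite list of matrices and on `γ`, so it does not depend on `ε` (`exists_uniform_bound`).

For the rate, `𝐀_ε(U_ε − U) = (𝐀₀ − 𝐀_ε)U`, and the right side is controlled by the `L²` norm of `(A
− A_ε)∇w` (`norm_op_sub_op_le`). This field lives on the defects, whose volume is `O(ε^d)`. As `w`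
is smooth and the `z_m` are interior points, `∇w` is bounded there, so the norm is `O(ε^{d/2})`
(`exists_norm_coeffMul_sub_le`). The uniform bound carries this over to `U_ε − U`. -/

theorem abs_re_inner_matAct_le (a : Matrix (Fin d) (Fin d) ℝ)
    (ξ : Metric.sphere (0 : EuclideanSpace ℂ (Fin d)) 1) :
    |(⟪(ξ : EuclideanSpace ℂ (Fin d)), matAct a ξ⟫_ℂ).re| ≤ ‖matAct a‖ := by
  refine (Complex.abs_re_le_norm _).trans ((norm_inner_le_norm _ _).trans ?_)
  have h : ‖(ξ : EuclideanSpace ℂ (Fin d))‖ = 1 := by simp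
  have := (matAct a).le_opNorm (ξ : EuclideanSpace ℂ (Fin d))
  rw [h] at this ⊢
  linarith

theorem re_inner_matAct_eq (a : Matrix (Fin d) (Fin d) ℝ) {ξ : EuclideanSpace ℂ (Fin d)}
    (hξ : ξ ≠ 0) :
    ∃ η : Metric.sphere (0 : EuclideanSpace ℂ (Fin d)) 1,
      (⟪ξ, matAct a ξ⟫_ℂ).re =
        (⟪(η : EuclideanSpace ℂ (Fin d)), matAct a η⟫_ℂ).re * ‖ξ‖ ^ 2 := by
  have hn : ‖ξ‖ ≠ 0 := norm_ne_zero_iff.2 hξ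
  refine ⟨⟨((‖ξ‖⁻¹ : ℝ) : ℂ) • ξ, ?_⟩, ?_⟩
  · simp [norm_smul, hn]
  · simp only [map_smul, inner_smul_left, inner_smul_right, Complex.conj_ofReal,
      Complex.re_ofReal_mul]
    field_simp

/-- The form is homogeneous of degree two, so unit vectors suffice. The operator norm bounds the
family from below, as the real infimum requires. -/
theorem quadMin_mul_le (a : Matrix (Fin d) (Fin d) ℝ) (ξ : EuclideanSpace ℂ (Fin d)) :
    quadMin a * ‖ξ‖ ^ 2 ≤ (⟪ξ, matAct a ξ⟫_ℂ).re := by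
  rcases eq_or_ne ξ 0 with rfl | hξ
  · simp
  obtain ⟨η, hη⟩ := re_inner_matAct_eq a hξ
  rw [hη]
  refine mul_le_mul_of_nonneg_right (ciInf_le ⟨-‖matAct a‖, ?_⟩ η) (sq_nonneg _)
  rintro _ ⟨ζ, rfl⟩
  exact (abs_le.1 (abs_re_inner_matAct_le a ζ)).1

theorem le_quadMax_mul (a : Matrix (Fin d) (Fin d) ℝ) (ξ : EuclideanSpace ℂ (Fin d)) :
    (⟪ξ, matAct a ξ⟫_ℂ).re ≤ quadMax a * ‖ξ‖ ^ 2 := by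
  rcases eq_or_ne ξ 0 with rfl | hξ
  · simp
  obtain ⟨η, hη⟩ := re_inner_matAct_eq a hξ
  rw [hη]
  refine mul_le_mul_of_nonneg_right (le_ciSup (f := fun ζ : Metric.sphere
    (0 : EuclideanSpace ℂ (Fin d)) 1 => (⟪(ζ : EuclideanSpace ℂ (Fin d)), matAct a ζ⟫_ℂ).re)
    ⟨‖matAct a‖, ?_⟩ η) (sq_nonneg _)
  rintro _ ⟨ζ, rfl⟩
  exact (abs_le.1 (abs_re_inner_matAct_le a ζ)).2

theorem quadMin_le_quadMax (hd : 0 < d) (a : Matrix (Fin d) (Fin d) ℝ) :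
    quadMin a ≤ quadMax a := by
  have h1 := quadMin_mul_le a (EuclideanSpace.single (⟨0, hd⟩ : Fin d) (1 : ℂ))
  have h2 := le_quadMax_mul a (EuclideanSpace.single (⟨0, hd⟩ : Fin d) (1 : ℂ))
  simp only [PiLp.norm_single, norm_one, one_pow, mul_one] at h1 h2
  exact h1.trans h2

theorem inner_matAct_comm {a : Matrix (Fin d) (Fin d) ℝ} (ha : a.IsSymm)
    (ξ η : EuclideanSpace ℂ (Fin d)) : ⟪matAct a ξ, η⟫_ℂ = ⟪ξ, matAct a η⟫_ℂ := by
  have h : (matAct a).adjoint = matAct a := by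
    have hH : (a.map (fun t : ℝ => (t : ℂ))).conjTranspose = a.map (fun t : ℝ => (t : ℂ)) := by
      ext i j
      simp [ha.apply]
    rw [matAct, ← ContinuousLinearMap.star_eq_adjoint, ← map_star, Matrix.star_eq_conjTranspose,
      hH]
  conv_lhs => rw [← h]
  exact ContinuousLinearMap.adjoint_inner_left _ _ _

end Matrices

/-! ### Operators that are bounded below -/

/-- The lower bound gives injectivity and a closed range. By symmetry the orthogonal complement of
the range is the kernel, which is zero, so the range is everything. -/
theorem isInvertible_of_symmetric_of_bound {E : Type*} [NormedAddCommGroup E]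
    [InnerProductSpace ℂ E] [CompleteSpace E] {T : E →L[ℂ] E} {c : ℝ} (hc : 0 < c)
    (hT : ∀ x y, ⟪T x, y⟫_ℂ = ⟪x, T y⟫_ℂ) (hb : ∀ x, c * ‖x‖ ≤ ‖T x‖) : T.IsInvertible := by
  have hanti : AntilipschitzWith (Real.toNNReal c⁻¹) T := by
    refine T.antilipschitz_of_bound fun x => ?_
    rw [Real.coe_toNNReal _ (by positivity), ← div_eq_inv_mul, le_div_iff₀ hc, mul_comm]
    exact hb x
  have hinj : T.ker = ⊥ := LinearMap.ker_eq_bot.2 hanti.injective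
  have hclosed : IsClosed (T.range : Set E) := hanti.isClosed_range T.uniformContinuous
  have hsymm : (T : E →ₗ[ℂ] E).IsSymmetric := hT
  have : CompleteSpace T.range := hclosed.completeSpace_coe
  have hrange : T.range = ⊤ := by
    rw [← Submodule.orthogonal_eq_bot_iff, hsymm.orthogonal_range]
    exact hinj
  exact ⟨ContinuousLinearEquiv.ofBijective T hinj hrange,
    ContinuousLinearEquiv.coe_ofBijective _ _ _⟩

/-! ### The spaces -/

section Spaces

variable {d : ℕ} {D : Opens (EuclideanSpace ℝ (Fin d))}

theorem norm_sq_H1 (u : H1 D) : ‖u‖ ^ 2 = ‖fn D u‖ ^ 2 + ‖grad D u‖ ^ 2 :=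
  WithLp.prod_norm_sq_eq_of_L2 (H1.incl D u)

theorem norm_sq_X (U : X D) : ‖U‖ ^ 2 = ‖wPart D U‖ ^ 2 + ‖vPart D U‖ ^ 2 :=
  WithLp.prod_norm_sq_eq_of_L2 (X.incl D U)

theorem inner_H1 (u v : H1 D) : ⟪u, v⟫_ℂ = ⟪fn D u, fn D v⟫_ℂ + ⟪grad D u, grad D v⟫_ℂ :=
  WithLp.prod_inner_apply (H1.incl D u) (H1.incl D v)

theorem norm_grad_le (u : H1 D) : ‖grad D u‖ ≤ ‖u‖ := by
  refine le_of_sq_le_sq ?_ (norm_nonneg _)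
  rw [norm_sq_H1]
  nlinarith [sq_nonneg ‖fn D u‖]

theorem norm_wPart_le (U : X D) : ‖wPart D U‖ ≤ ‖U‖ := by
  refine le_of_sq_le_sq ?_ (norm_nonneg _)
  rw [norm_sq_X]
  nlinarith [sq_nonneg ‖vPart D U‖]

theorem norm_vPart_le (U : X D) : ‖vPart D U‖ ≤ ‖U‖ := by
  refine le_of_sq_le_sq ?_ (norm_nonneg _)
  rw [norm_sq_X]
  nlinarith [sq_nonneg ‖wPart D U‖]

theorem wPart_sub_vPart_mem (U : X D) : wPart D U - vPart D U ∈ H10 D :=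
  (show XSub D from U).2

theorem exists_X (w v : H1 D) (h : w - v ∈ H10 D) :
    ∃ U : X D, wPart D U = w ∧ vPart D U = v :=
  ⟨(⟨WithLp.toLp 2 (w, v), h⟩ : XSub D), rfl, rfl⟩

end Spaces

/-! ### Multiplication by a matrix field -/

section CoeffMul

variable {d : ℕ} (D : Opens (EuclideanSpace ℝ (Fin d)))

/-- Multiplication by a bounded matrix field on `L²(D; ℂ^d)`. -/
def coeffMul (a : Coeff d) : L2Vec D →L[ℂ] L2Vec D :=
  (exists_coeffMul D a).choose

theorem coeffMul_ae (a : Coeff d) (G : L2Vec D) :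
    (coeffMul D a G : EuclideanSpace ℝ (Fin d) → EuclideanSpace ℂ (Fin d))
      =ᵐ[volume.restrict (D : Set (EuclideanSpace ℝ (Fin d)))]
        fun x => matAct (a.toFun x) (G x) :=
  (exists_coeffMul D a).choose_spec G

theorem inner_coeffMul (a : Coeff d) (G H : L2Vec D) :
    ⟪G, coeffMul D a H⟫_ℂ =
      ∫ x in (D : Set (EuclideanSpace ℝ (Fin d))), ⟪G x, matAct (a.toFun x) (H x)⟫_ℂ := by
  rw [L2.inner_def]
  refine integral_congr_ae ?_
  filter_upwards [coeffMul_ae D a H] with x hx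
  rw [hx]

theorem integrable_inner_matAct (a : Coeff d) (G H : L2Vec D) :
    Integrable (fun x => ⟪G x, matAct (a.toFun x) (H x)⟫_ℂ)
      (volume.restrict (D : Set (EuclideanSpace ℝ (Fin d)))) := by
  refine (L2.integrable_inner (𝕜 := ℂ) G (coeffMul D a H)).congr ?_
  filter_upwards [coeffMul_ae D a H] with x hx
  rw [hx]

/-- With the integrals replaced by inner products, the coercivity estimates become Hilbert space
algebra. -/
theorem form_eq (a : Coeff d) (γ : ℝ) (U Φ : X D) :
    form D a γ U Φ =
      ⟪grad D (wPart D Φ), coeffMul D a (grad D (wPart D U))⟫_ℂ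
        + (γ : ℂ) * ⟪fn D (wPart D Φ), fn D (wPart D U)⟫_ℂ - ⟪vPart D Φ, vPart D U⟫_ℂ := by
  rw [form, integral_add (integrable_inner_matAct D a _ _)
    ((L2.integrable_inner (𝕜 := ℂ) _ _).const_mul _), integral_add
    (L2.integrable_inner (𝕜 := ℂ) _ _) (L2.integrable_inner (𝕜 := ℂ) _ _), integral_const_mul,
    inner_coeffMul, inner_H1, L2.inner_def, L2.inner_def, L2.inner_def]
  ring

variable {D}

theorem inner_coeffMul_comm {a : Coeff d} (ha : ∀ x, (a.toFun x).IsSymm) (G H : L2Vec D) :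
    ⟪coeffMul D a G, H⟫_ℂ = ⟪G, coeffMul D a H⟫_ℂ := by
  rw [inner_coeffMul, L2.inner_def]
  refine integral_congr_ae ?_
  filter_upwards [coeffMul_ae D a G] with x hx
  rw [hx, inner_matAct_comm (ha x)]

theorem re_inner_coeffMul (a : Coeff d) (G : L2Vec D) :
    (⟪G, coeffMul D a G⟫_ℂ).re =
      ∫ x in (D : Set (EuclideanSpace ℝ (Fin d))), (⟪G x, matAct (a.toFun x) (G x)⟫_ℂ).re := by
  rw [inner_coeffMul]
  exact (integral_re (integrable_inner_matAct D a G G)).symm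

theorem norm_sq_L2Vec (G : L2Vec D) :
    ‖G‖ ^ 2 = ∫ x in (D : Set (EuclideanSpace ℝ (Fin d))), ‖G x‖ ^ 2 := by
  have h := L2.inner_def (𝕜 := ℂ) G G
  rw [inner_self_eq_norm_sq_to_K] at h
  simp only [inner_self_eq_norm_sq_to_K] at h
  have h2 : (∫ x in (D : Set (EuclideanSpace ℝ (Fin d))), ((‖G x‖ : ℂ) ^ 2)) =
      ((∫ x in (D : Set (EuclideanSpace ℝ (Fin d))), ‖G x‖ ^ 2 : ℝ) : ℂ) := by
    rw [← integral_complex_ofReal]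
    simp
  have h3 := h.trans h2
  norm_cast at h3
  exact Complex.ofReal_injective h3

theorem integrable_norm_sq (G : L2Vec D) :
    Integrable (fun x => ‖G x‖ ^ 2) (volume.restrict (D : Set (EuclideanSpace ℝ (Fin d)))) :=
  (memLp_two_iff_integrable_sq_norm (Lp.memLp G).1).1 (Lp.memLp G)

theorem le_re_inner_coeffMul {a : Coeff d} {α : ℝ}
    (ha : ∀ x (ξ : EuclideanSpace ℂ (Fin d)),
      α * ‖ξ‖ ^ 2 ≤ (⟪ξ, matAct (a.toFun x) ξ⟫_ℂ).re) (G : L2Vec D) :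
    α * ‖G‖ ^ 2 ≤ (⟪G, coeffMul D a G⟫_ℂ).re := by
  rw [re_inner_coeffMul, norm_sq_L2Vec, ← integral_const_mul]
  exact integral_mono ((integrable_norm_sq G).const_mul _) (integrable_inner_matAct D a G G).re
    fun x => ha x _

theorem re_inner_coeffMul_le {a : Coeff d} {β : ℝ}
    (ha : ∀ x (ξ : EuclideanSpace ℂ (Fin d)),
      (⟪ξ, matAct (a.toFun x) ξ⟫_ℂ).re ≤ β * ‖ξ‖ ^ 2) (G : L2Vec D) :
    (⟪G, coeffMul D a G⟫_ℂ).re ≤ β * ‖G‖ ^ 2 := by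
  rw [re_inner_coeffMul, norm_sq_L2Vec, ← integral_const_mul]
  exact integral_mono (integrable_inner_matAct D a G G).re ((integrable_norm_sq G).const_mul _)
    fun x => ha x _

end CoeffMul

/-! ### `T`-coercivity -/

section Coercivity

variable {d : ℕ} {D : Opens (EuclideanSpace ℝ (Fin d))} {a : Coeff d}

theorem op_symmetric (ha : ∀ x, (a.toFun x).IsSymm) (γ : ℝ) (U V : X D) :
    ⟪op D a γ U, V⟫_ℂ = ⟪U, op D a γ V⟫_ℂ := by
  rw [← inner_conj_symm, inner_op, inner_op, form_eq, form_eq]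
  simp only [map_add, map_sub, map_mul, inner_conj_symm, Complex.conj_ofReal,
    inner_coeffMul_comm ha]

/-- Cauchy–Schwarz: `c‖U‖² ≤ Re (V, 𝐀U) ≤ 3‖U‖‖𝐀U‖`, then division by `‖U‖`. -/
theorem bound_of_coercive {γ c : ℝ} {U V : X D} (hV : ‖V‖ ≤ 3 * ‖U‖)
    (h : c * ‖U‖ ^ 2 ≤ (form D a γ U V).re) : c / 3 * ‖U‖ ≤ ‖op D a γ U‖ := by
  rcases (norm_nonneg U).eq_or_lt with h0 | h0
  · rw [← h0]
    simp
  have h1 : (form D a γ U V).re ≤ ‖V‖ * ‖op D a γ U‖ := by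
    rw [← inner_op]
    exact (Complex.re_le_norm _).trans (norm_inner_le_norm _ _)
  have h2 : ‖V‖ * ‖op D a γ U‖ ≤ 3 * ‖U‖ * ‖op D a γ U‖ :=
    mul_le_mul_of_nonneg_right hV (norm_nonneg _)
  refine le_of_mul_le_mul_left ?_ h0
  linarith [h1, h2]

/-- The matrix with rows `(1, 2)` and `(2, 1)` has norm 3. The hypotheses are loose enough to serve
both choices of test pair. -/
theorem norm_le_of_parts {U V : X D} (hw : ‖wPart D V‖ ≤ ‖wPart D U‖ + 2 * ‖vPart D U‖)
    (hv : ‖vPart D V‖ ≤ 2 * ‖wPart D U‖ + ‖vPart D U‖) : ‖V‖ ≤ 3 * ‖U‖ := by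
  refine le_of_sq_le_sq ?_ (by positivity)
  have h1 := pow_le_pow_left₀ (norm_nonneg _) hw 2
  have h2 := pow_le_pow_left₀ (norm_nonneg _) hv 2
  rw [mul_pow, norm_sq_X, norm_sq_X]
  nlinarith [sq_nonneg (‖wPart D U‖ - ‖vPart D U‖)]

theorem bound_of_one_lt {γ α : ℝ} (hα : 1 < α) (hαγ : α ≤ γ)
    (hlow : ∀ x (ξ : EuclideanSpace ℂ (Fin d)),
      α * ‖ξ‖ ^ 2 ≤ (⟪ξ, matAct (a.toFun x) ξ⟫_ℂ).re) (U : X D) :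
    (α - 1) / (α + 1) / 3 * ‖U‖ ≤ ‖op D a γ U‖ := by
  -- The test pair is `(w, 2w − v)`; the difference of its components is `−(w − v)`.
  have hmem : wPart D U - ((2 : ℂ) • wPart D U - vPart D U) ∈ H10 D := by
    have := (H10 D).neg_mem (wPart_sub_vPart_mem U)
    rwa [show wPart D U - ((2 : ℂ) • wPart D U - vPart D U) = -(wPart D U - vPart D U) by
      rw [two_smul]; abel]
  obtain ⟨V, hVw, hVv⟩ := exists_X _ _ hmem
  refine bound_of_coercive (V := V) (norm_le_of_parts ?_ ?_) ?_
  · rw [hVw]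
    linarith [norm_nonneg (vPart D U)]
  · rw [hVv]
    refine (norm_sub_le _ _).trans ?_
    rw [norm_smul]
    simp
  · set w := wPart D U
    set v := vPart D U
    have h1 := le_re_inner_coeffMul hlow (grad D w)
    have h2 : (⟪w, v⟫_ℂ).re ≤ ‖w‖ * ‖v‖ := (Complex.re_le_norm _).trans (norm_inner_le_norm _ _)
    have h3 := norm_sq_H1 w
    have hf : (⟪fn D w, fn D w⟫_ℂ).re = ‖fn D w‖ ^ 2 := inner_self_eq_norm_sq (𝕜 := ℂ) _
    have hv : (⟪v, v⟫_ℂ).re = ‖v‖ ^ 2 := inner_self_eq_norm_sq (𝕜 := ℂ) v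
    have hform : (form D a γ U V).re = (⟪grad D w, coeffMul D a (grad D w)⟫_ℂ).re
        + γ * ‖fn D w‖ ^ 2 - 2 * (⟪w, v⟫_ℂ).re + ‖v‖ ^ 2 := by
      rw [form_eq, hVw, hVv, inner_sub_left, inner_smul_left,
        show wPart D U = w from rfl, show vPart D U = v from rfl, ← hf, ← hv]
      simp [-inner_self_eq_norm_sq_to_K]
      ring
    have h4 : α * ‖fn D w‖ ^ 2 ≤ γ * ‖fn D w‖ ^ 2 :=
      mul_le_mul_of_nonneg_right hαγ (sq_nonneg _)
    -- The quadratic form with rows `(α, −1)` and `(−1, 1)` has determinant `α − 1` and trace `α +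
    -- 1`, so its least eigenvalue is at least their quotient. After clearing denominators the gap
    -- is the sum of the two squares given as hints.
    have h5 : (α - 1) / (α + 1) * (‖w‖ ^ 2 + ‖v‖ ^ 2) ≤
        α * ‖w‖ ^ 2 - 2 * (‖w‖ * ‖v‖) + ‖v‖ ^ 2 := by
      rw [div_mul_eq_mul_div, div_le_iff₀ (by linarith)]
      nlinarith [sq_nonneg (α * ‖w‖ - ‖v‖), sq_nonneg (‖w‖ - ‖v‖)]
    rw [norm_sq_X, hform]
    nlinarith

/-- Here `Q`, `P` and `R` stand for `(Sx, x)`, `(Sy, y)` and `Re (Sx, y)` for a nonnegative form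
`S`, and `g` for `‖y‖²`; the last hypothesis is positivity at `x − ty`. It is used once for
gradients and once for function values. -/
theorem quadratic_lower_bound {β Q P R g : ℝ} (hβ0 : 0 < β) (hβ : β < 1)
    (hP : P ≤ β * g) (hg : 0 ≤ g) (hR : ∀ t : ℝ, 0 ≤ Q - 2 * t * R + t ^ 2 * P) :
    (1 - β) / 2 * (Q + g) ≤ Q - 2 * R + g := by
  -- This `t` turns positivity into Young's inequality with weight `(1 + β)/2 < 1` on `Q`. Since `4β
  -- ≤ (1 + β)²`, the term in `P ≤ βg` costs at most the same weight on `g`, leaving `(1 − β)/2` of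
  -- both.
  have h := hR (2 / (1 + β))
  have h1 : 0 < 1 + β := by linarith
  have h2 : 2 * R ≤ (1 + β) / 2 * Q + 2 / (1 + β) * P := by
    have : 0 ≤ (1 + β) / 2 * (Q - 2 * (2 / (1 + β)) * R + (2 / (1 + β)) ^ 2 * P) := by positivity
    have e : (1 + β) / 2 * (Q - 2 * (2 / (1 + β)) * R + (2 / (1 + β)) ^ 2 * P) =
      (1 + β) / 2 * Q - 2 * R + 2 / (1 + β) * P := by field_simp
    linarith
  have h3 : 2 / (1 + β) * P ≤ (1 + β) / 2 * g := by
    calc 2 / (1 + β) * P ≤ 2 / (1 + β) * (β * g) := by gcongr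
      _ = 2 * β / (1 + β) * g := by ring
      _ ≤ (1 + β) / 2 * g := by
        gcongr ?_ * g
        rw [div_le_div_iff₀ h1 two_pos]
        nlinarith [sq_nonneg (1 - β)]
  linarith

theorem bound_of_lt_one {γ α β : ℝ} (hα : 0 < α) (hα1 : α ≤ 1) (hαγ : α ≤ γ) (hγβ : γ ≤ β)
    (hβ : β < 1) (hsymm : ∀ x, (a.toFun x).IsSymm)
    (hlow : ∀ x (ξ : EuclideanSpace ℂ (Fin d)),
      α * ‖ξ‖ ^ 2 ≤ (⟪ξ, matAct (a.toFun x) ξ⟫_ℂ).re)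
    (hupp : ∀ x (ξ : EuclideanSpace ℂ (Fin d)),
      (⟪ξ, matAct (a.toFun x) ξ⟫_ℂ).re ≤ β * ‖ξ‖ ^ 2) (U : X D) :
    (1 - β) / 2 * α / 3 * ‖U‖ ≤ ‖op D a γ U‖ := by
  -- The test pair is `(w − 2v, −v)`, whose components differ by exactly `w − v`.
  have hmem : (wPart D U - (2 : ℂ) • vPart D U) - (-vPart D U) ∈ H10 D := by
    have := wPart_sub_vPart_mem U
    rwa [show (wPart D U - (2 : ℂ) • vPart D U) - (-vPart D U) = wPart D U - vPart D U by
      rw [two_smul]; abel]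
  obtain ⟨V, hVw, hVv⟩ := exists_X _ _ hmem
  refine bound_of_coercive (V := V) (norm_le_of_parts ?_ ?_) ?_
  · rw [hVw]
    refine (norm_sub_le _ _).trans ?_
    rw [norm_smul]
    simp
  · rw [hVv, norm_neg]
    linarith [norm_nonneg (wPart D U)]
  · set w := wPart D U
    set v := vPart D U
    set S := coeffMul D a
    have hγ0 : 0 < γ := hα.trans_le hαγ
    have hβ0 : 0 < β := hγ0.trans_le hγβ
    have h1 := le_re_inner_coeffMul hlow (grad D w)
    have hfw : (⟪fn D w, fn D w⟫_ℂ).re = ‖fn D w‖ ^ 2 := inner_self_eq_norm_sq (𝕜 := ℂ) _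
    have hv : (⟪v, v⟫_ℂ).re = ‖v‖ ^ 2 := inner_self_eq_norm_sq (𝕜 := ℂ) v
    have hform : (form D a γ U V).re = (⟪grad D w, S (grad D w)⟫_ℂ).re
        - 2 * (⟪grad D v, S (grad D w)⟫_ℂ).re
        + (γ * ‖fn D w‖ ^ 2 - 2 * (γ * (⟪fn D v, fn D w⟫_ℂ).re)) + ‖v‖ ^ 2 := by
      rw [form_eq, hVw, hVv, inner_neg_left, show wPart D U = w from rfl,
        show vPart D U = v from rfl, ← hfw, ← hv]
      simp only [map_sub, map_smul, inner_sub_left, inner_smul_left]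
      simp [-inner_self_eq_norm_sq_to_K]
      ring
    -- The cross term is absorbed using the energy of the matrix field, for which `∇v` has energy at
    -- most `β‖∇v‖²`.
    have hgrad : (1 - β) / 2 * ((⟪grad D w, S (grad D w)⟫_ℂ).re + ‖grad D v‖ ^ 2) ≤
        (⟪grad D w, S (grad D w)⟫_ℂ).re - 2 * (⟪grad D v, S (grad D w)⟫_ℂ).re
          + ‖grad D v‖ ^ 2 := by
      refine quadratic_lower_bound hβ0 hβ (re_inner_coeffMul_le hupp (grad D v)) (sq_nonneg _) ?_
      intro t
      have h := le_re_inner_coeffMul hlow (grad D w - (t : ℂ) • grad D v)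
      have h0 : 0 ≤ α * ‖grad D w - (t : ℂ) • grad D v‖ ^ 2 := by positivity
      have hs : (⟪grad D w, S (grad D v)⟫_ℂ).re = (⟪grad D v, S (grad D w)⟫_ℂ).re := by
        rw [← inner_coeffMul_comm hsymm, ← inner_conj_symm, Complex.conj_re]
      have e : (⟪grad D w - (t : ℂ) • grad D v, S (grad D w - (t : ℂ) • grad D v)⟫_ℂ).re =
          (⟪grad D w, S (grad D w)⟫_ℂ).re - 2 * t * (⟪grad D v, S (grad D w)⟫_ℂ).re
            + t ^ 2 * (⟪grad D v, S (grad D v)⟫_ℂ).re := by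
        simp only [map_sub, map_smul, inner_sub_left, inner_sub_right, inner_smul_left,
          inner_smul_right, Complex.conj_ofReal, Complex.sub_re, Complex.re_ofReal_mul, hs]
        ring
      linarith
    -- The same argument for the zeroth-order terms, with the scalar `γ ≤ β` in place of the matrix
    -- field.
    have hfn : (1 - β) / 2 * (γ * ‖fn D w‖ ^ 2 + ‖fn D v‖ ^ 2) ≤
        γ * ‖fn D w‖ ^ 2 - 2 * (γ * (⟪fn D v, fn D w⟫_ℂ).re) + ‖fn D v‖ ^ 2 := by
      refine quadratic_lower_bound hβ0 hβ (P := γ * ‖fn D v‖ ^ 2) (by gcongr) (sq_nonneg _) ?_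
      intro t
      have h0 : 0 ≤ γ * ‖fn D w - (t : ℂ) • fn D v‖ ^ 2 := by positivity
      have e : ‖fn D w - (t : ℂ) • fn D v‖ ^ 2 =
          ‖fn D w‖ ^ 2 - 2 * t * (⟪fn D v, fn D w⟫_ℂ).re + t ^ 2 * ‖fn D v‖ ^ 2 := by
        have hs : (⟪fn D w, fn D v⟫_ℂ).re = (⟪fn D v, fn D w⟫_ℂ).re := by
          rw [← inner_conj_symm, Complex.conj_re]
        rw [@norm_sub_sq ℂ, norm_smul, inner_smul_right, mul_pow]
        simp [hs]
        ring
      rw [e] at h0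
      linarith
    have h3 := norm_sq_H1 w
    have h4 := norm_sq_H1 v
    have h5 : (1 - β) / 2 * (α * (‖w‖ ^ 2 + ‖v‖ ^ 2)) ≤
        (1 - β) / 2 * ((⟪grad D w, S (grad D w)⟫_ℂ).re + ‖grad D v‖ ^ 2
          + (γ * ‖fn D w‖ ^ 2 + ‖fn D v‖ ^ 2)) := by
      refine mul_le_mul_of_nonneg_left ?_ (by linarith)
      have h6 : α * ‖fn D w‖ ^ 2 ≤ γ * ‖fn D w‖ ^ 2 :=
        mul_le_mul_of_nonneg_right hαγ (sq_nonneg _)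
      have h7 : α * ‖v‖ ^ 2 ≤ ‖v‖ ^ 2 := mul_le_of_le_one_left (sq_nonneg _) hα1
      rw [h3] at *
      linarith
    rw [norm_sq_X, hform]
    linarith

end Coercivity

/-! ### The weak gradient of a smooth function -/

section SmoothGradient

variable {d : ℕ} {D : Opens (EuclideanSpace ℝ (Fin d))}

theorem continuousOn_fderiv_apply {W : EuclideanSpace ℝ (Fin d) → ℂ} (hW : ContDiffOn ℝ ∞ W D)
    (e : EuclideanSpace ℝ (Fin d)) : ContinuousOn (fun x => fderiv ℝ W x e) D :=
  (hW.continuousOn_fderiv_of_isOpen D.isOpen (by simp)).clm_apply continuousOn_const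

/-- Although `f` is continuous only on `D`, the product is continuous everywhere: near points
outside the support of `g` it vanishes. -/
theorem integrable_mul_test {f : EuclideanSpace ℝ (Fin d) → ℂ} (hf : ContinuousOn f D)
    {g : EuclideanSpace ℝ (Fin d) → ℂ} (hg : Continuous g) (hgc : HasCompactSupport g)
    (hgs : tsupport g ⊆ D) : Integrable (fun x => f x * g x) := by
  refine Continuous.integrable_of_hasCompactSupport ?_ hgc.mul_left
  refine continuous_of_tsupport fun x hx => ?_
  have hxD : x ∈ D := hgs (tsupport_mul_subset_right hx)
  exact (hf.continuousAt (D.isOpen.mem_nhds hxD)).mul hg.continuousAt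

theorem setIntegral_mul_test (f : EuclideanSpace ℝ (Fin d) → ℂ)
    {g : EuclideanSpace ℝ (Fin d) → ℂ} (hgs : tsupport g ⊆ D) :
    ∫ x in (D : Set (EuclideanSpace ℝ (Fin d))), f x * g x = ∫ x, f x * g x := by
  refine setIntegral_eq_integral_of_forall_compl_eq_zero fun x hx => ?_
  rw [image_eq_zero_of_notMem_tsupport fun h => hx (hgs h), mul_zero]

/-- The weak gradient of an `H¹` function that is smooth in `D` is the classical one. -/
theorem grad_ae_eq_fderiv {u : H1 D} {W : EuclideanSpace ℝ (Fin d) → ℂ}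
    (hW : ContDiffOn ℝ ∞ W D)
    (hu : (fn D u : EuclideanSpace ℝ (Fin d) → ℂ)
      =ᵐ[volume.restrict (D : Set (EuclideanSpace ℝ (Fin d)))] W) (i : Fin d) :
    (fun x => grad D u x i) =ᵐ[volume.restrict (D : Set (EuclideanSpace ℝ (Fin d)))]
      fun x => fderiv ℝ W x (EuclideanSpace.single i (1 : ℝ)) := by
  set e : EuclideanSpace ℝ (Fin d) := EuclideanSpace.single i (1 : ℝ)
  have hcont := continuousOn_fderiv_apply hW e
  have hmeas : MeasurableSet (D : Set (EuclideanSpace ℝ (Fin d))) := D.isOpen.measurableSet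
  have hloc : LocallyIntegrableOn (fun x => grad D u x i - fderiv ℝ W x e)
      (D : Set (EuclideanSpace ℝ (Fin d))) volume := by
    refine LocallyIntegrableOn.sub ?_ (hcont.locallyIntegrableOn hmeas)
    have h := (memLp_coord (grad D u) i).locallyIntegrable (by norm_num)
    exact locallyIntegrableOn_of_locallyIntegrable_restrict h
  -- Fundamental lemma of the calculus of variations: it remains to show that the difference of the
  -- weak and classical derivatives integrates to zero against every real test function.
  have hzero := IsOpen.ae_eq_zero_of_integral_contDiff_smul_eq_zero D.isOpen hloc ?_
  · rw [EventuallyEq, ae_restrict_iff' hmeas]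
    filter_upwards [hzero] with x hx hxD
    exact sub_eq_zero.1 (hx hxD)
  intro g hg hgc hgs
  have hsupp : tsupport (fun x => (g x : ℂ)) = tsupport g := by
    unfold tsupport
    congr 1
    ext x
    simp
  let φ : 𝓓(D, ℂ) := ⟨fun x => (g x : ℂ), Complex.ofRealCLM.contDiff.comp hg,
    hgc.comp_left (g := fun t : ℝ => (t : ℂ)) Complex.ofReal_zero, hsupp.trans_subset hgs⟩
  have hφ : ∀ x, φ x = (g x : ℂ) := fun _ => rfl
  have hφs : tsupport φ ⊆ D := φ.tsupport_subset
  have hφd : Continuous fun x => fderiv ℝ φ x e :=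
    (φ.contDiff.continuous_fderiv (by simp)).clm_apply continuous_const
  have hφds : tsupport (fun x => fderiv ℝ φ x e) ⊆ D :=
    (closure_minimal (fun x hx => by
      by_contra h
      refine hx ?_
      change fderiv ℝ φ x e = 0
      rw [image_eq_zero_of_notMem_tsupport (fun h' => h (tsupport_fderiv_subset ℝ h'))]
      rfl) (isClosed_tsupport φ)).trans hφs
  have hφdc : HasCompactSupport fun x => fderiv ℝ φ x e :=
    φ.hasCompactSupport.fderiv_apply (𝕜 := ℝ) _
  -- Classical integration by parts, to be compared with the defining identity of the weak gradient
  -- for the same `φ`.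
  have hparts : ∫ x, W x * fderiv ℝ φ x e = - ∫ x, fderiv ℝ W x e * φ x := by
    refine integral_mul_fderiv_eq_neg_fderiv_mul_of_integrable
      (integrable_mul_test hcont φ.continuous φ.hasCompactSupport hφs)
      (integrable_mul_test hW.continuousOn hφd hφdc hφds)
      (integrable_mul_test hW.continuousOn φ.continuous φ.hasCompactSupport hφs) ?_ ?_
    · intro x hx
      exact (hW.differentiableOn (by simp)).differentiableAt (D.isOpen.mem_nhds (hφs hx))
    · intro x _
      exact φ.contDiff.differentiable (by simp) x
  have hweak : IsWeakGradient D (fn D u) (grad D u) := (show H1Sub D from u).2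
  have hweak := hweak φ i
  rw [integral_congr_ae (g := fun x => W x * fderiv ℝ φ x e) (by
    filter_upwards [hu] with x hx
    rw [hx]), setIntegral_mul_test W hφds, hparts, neg_inj,
    ← setIntegral_mul_test _ hφs] at hweak
  have hfin : ∫ x, g x • (grad D u x i - fderiv ℝ W x e) =
      ∫ x in (D : Set (EuclideanSpace ℝ (Fin d))),
        (grad D u x i * φ x - fderiv ℝ W x e * φ x) := by
    simp_rw [← sub_mul]
    rw [setIntegral_mul_test _ hφs]
    refine integral_congr_ae (Eventually.of_forall fun x => ?_)
    simp only [hφ, Complex.real_smul, mul_comm]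
  rw [hfin, integral_sub (integrable_right _ φ i)
    (integrable_mul_test hcont φ.continuous φ.hasCompactSupport hφs).restrict, hweak, sub_self]

/-- The weak gradient of an `H¹` function that is smooth in `D` is bounded near each point. -/
theorem exists_bound_grad_near {u : H1 D} {W : EuclideanSpace ℝ (Fin d) → ℂ}
    (hW : ContDiffOn ℝ ∞ W D)
    (hu : (fn D u : EuclideanSpace ℝ (Fin d) → ℂ)
      =ᵐ[volume.restrict (D : Set (EuclideanSpace ℝ (Fin d)))] W)
    {z : EuclideanSpace ℝ (Fin d)} (hz : z ∈ D) :
    ∃ r > 0, ∃ K : ℝ, ∀ᵐ x ∂volume.restrict (D : Set (EuclideanSpace ℝ (Fin d))),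
      x ∈ Metric.closedBall z r → ‖grad D u x‖ ≤ K := by
  obtain ⟨r, hr, hrD⟩ := Metric.nhds_basis_closedBall.mem_iff.1 (D.isOpen.mem_nhds hz)
  have hb : ∀ i : Fin d, ∃ K : ℝ, ∀ x ∈ Metric.closedBall z r,
      ‖fderiv ℝ W x (EuclideanSpace.single i (1 : ℝ))‖ ≤ K := fun i =>
    (isCompact_closedBall z r).exists_bound_of_continuousOn
      ((continuousOn_fderiv_apply hW _).mono hrD)
  choose K hK using hb
  refine ⟨r, hr, ∑ i, K i, ?_⟩
  filter_upwards [ae_all_iff.2 fun i => grad_ae_eq_fderiv hW hu i] with x hx hxr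
  have hsum : grad D u x = ∑ i, (grad D u x i) • EuclideanSpace.single i (1 : ℂ) := by
    ext j
    simp [Finset.sum_apply, Pi.single_apply]
  rw [hsum]
  refine norm_sum_le_of_le _ fun i _ => ?_
  rw [norm_smul, PiLp.norm_single, norm_one, mul_one, hx i]
  exact hK i x hxr

end SmoothGradient

/-! ### Uniform invertibility for piecewise constant coefficients -/

/-- A minimum of finitely many numbers keeps the strict inequality. Indexing by `Option (Fin M)`
includes `c` and keeps the family nonempty when `M = 0`. -/
theorem exists_lower_bound {M : ℕ} {b c : ℝ} {f : Fin M → ℝ} (hc : b < c) (hf : ∀ m, b < f m) :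
    ∃ α, b < α ∧ α ≤ c ∧ ∀ m, α ≤ f m := by
  obtain ⟨o, ho⟩ := Finite.exists_min fun o : Option (Fin M) => o.elim c f
  refine ⟨o.elim c f, ?_, ho none, fun m => ho (some m)⟩
  cases o with
  | none => exact hc
  | some m => exact hf m

theorem exists_upper_bound {M : ℕ} {b c : ℝ} {f : Fin M → ℝ} (hc : c < b) (hf : ∀ m, f m < b) :
    ∃ β, β < b ∧ c ≤ β ∧ ∀ m, f m ≤ β := by
  obtain ⟨α, h1, h2, h3⟩ := exists_lower_bound (neg_lt_neg hc) (fun m => neg_lt_neg (hf m))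
  exact ⟨-α, by linarith, by linarith, fun m => by linarith [h3 m]⟩

section Estimates

variable {d M : ℕ} {D : Opens (EuclideanSpace ℝ (Fin d))} {A : Matrix (Fin d) (Fin d) ℝ}
  {Am : Fin M → Matrix (Fin d) (Fin d) ℝ} {γ : ℝ}

/-- The constant is chosen before the coefficient field, so a single `c` serves `A₀` and every `A_ε`
with disjoint defects. -/
theorem exists_uniform_bound (hd : 0 < d) (hA : A.IsSymm) (hAm : ∀ m, (Am m).IsSymm)
    (hγ : (1 < quadMin A ∧ (∀ m, 1 < quadMin (Am m)) ∧ γ = quadMin A) ∨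
      (0 < quadMin A ∧ (∀ m, 0 < quadMin (Am m)) ∧
        quadMax A < 1 ∧ (∀ m, quadMax (Am m) < 1) ∧ γ = quadMax A)) :
    ∃ c > 0, ∀ a : Coeff d, (∀ x, a.toFun x = A ∨ ∃ m, a.toFun x = Am m) →
      ∀ U : X D, c * ‖U‖ ≤ ‖op D a γ U‖ := by
  have low : ∀ {α : ℝ}, α ≤ quadMin A → (∀ m, α ≤ quadMin (Am m)) → ∀ a : Coeff d,
      (∀ x, a.toFun x = A ∨ ∃ m, a.toFun x = Am m) → ∀ x (ξ : EuclideanSpace ℂ (Fin d)),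
      α * ‖ξ‖ ^ 2 ≤ (⟪ξ, matAct (a.toFun x) ξ⟫_ℂ).re := by
    intro α h0 hm a ha x ξ
    have hq : α ≤ quadMin (a.toFun x) := by
      rcases ha x with h | ⟨m, h⟩ <;> rw [h]
      exacts [h0, hm m]
    exact (mul_le_mul_of_nonneg_right hq (sq_nonneg _)).trans (quadMin_mul_le _ _)
  rcases hγ with ⟨h0, hm, rfl⟩ | ⟨h0, hm, h1, hm1, rfl⟩
  · obtain ⟨α, hα, hα0, hαm⟩ := exists_lower_bound h0 hm
    exact ⟨(α - 1) / (α + 1) / 3,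
      div_pos (div_pos (by linarith) (by linarith)) (by norm_num), fun a ha =>
      bound_of_one_lt hα hα0 (low hα0 hαm a ha)⟩
  · obtain ⟨α, hα, hα0, hαm⟩ := exists_lower_bound h0 hm
    obtain ⟨β, hβ, hβ0, hβm⟩ := exists_upper_bound h1 hm1
    -- In this regime `γ = A_max`, so `α ≤ A_min` has to be passed through `A_min ≤ A_max`.
    have hαγ : α ≤ quadMax A := hα0.trans (quadMin_le_quadMax hd A)
    refine ⟨(1 - β) / 2 * α / 3, div_pos (mul_pos (by linarith) hα) (by norm_num), fun a ha =>
      bound_of_lt_one hα (by linarith) hαγ hβ0 hβ ?_ (low hα0 hαm a ha) ?_⟩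
    · intro x
      rcases ha x with h | ⟨m, h⟩ <;> rw [h]
      exacts [hA, hAm m]
    · intro x ξ
      have hq : quadMax (a.toFun x) ≤ β := by
        rcases ha x with h | ⟨m, h⟩ <;> rw [h]
        exacts [hβ0, hβm m]
      exact (le_quadMax_mul _ _).trans (mul_le_mul_of_nonneg_right hq (sq_nonneg _))

theorem op_isInvertible (hA : A.IsSymm) (hAm : ∀ m, (Am m).IsSymm) {c : ℝ} (hc : 0 < c)
    {a : Coeff d} (ha : ∀ x, a.toFun x = A ∨ ∃ m, a.toFun x = Am m)
    (hb : ∀ U : X D, c * ‖U‖ ≤ ‖op D a γ U‖) : (op D a γ).IsInvertible := by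
  refine isInvertible_of_symmetric_of_bound hc (op_symmetric (fun x => ?_) γ) hb
  rcases ha x with h | ⟨m, h⟩ <;> rw [h]
  exacts [hA, hAm m]

theorem defectCoeff_values {z : Fin M → EuclideanSpace ℝ (Fin d)}
    {B : Fin M → Set (EuclideanSpace ℝ (Fin d))} (hB : ∀ m, MeasurableSet (B m)) {ε : ℝ}
    (hd : Pairwise fun i j => Disjoint (region (z i) (B i) ε) (region (z j) (B j) ε))
    (x : EuclideanSpace ℝ (Fin d)) :
    (defectCoeff A Am z B hB ε).toFun x = A ∨
      ∃ m, (defectCoeff A Am z B hB ε).toFun x = Am m := by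
  by_cases h : ∃ m, x ∈ region (z m) (B m) ε
  · obtain ⟨m, hm⟩ := h
    exact Or.inr ⟨m, defectCoeff_of_mem A Am z B hB ε hd m hm⟩
  · exact Or.inl (defectCoeff_of_notMem A Am z B hB ε fun m hm => h ⟨m, hm⟩)

/-! ### The size of the defect -/

theorem region_subset_closedBall {z : EuclideanSpace ℝ (Fin d)}
    {B : Set (EuclideanSpace ℝ (Fin d))} {R ε : ℝ} (hB : B ⊆ Metric.closedBall 0 R)
    (hε : 0 < ε) : region z B ε ⊆ Metric.closedBall z (ε * R) := by
  rintro _ ⟨y, hy, rfl⟩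
  have := mem_closedBall_zero_iff.1 (hB hy)
  rw [mem_closedBall_iff_norm, add_sub_cancel_left, norm_smul, Real.norm_of_nonneg hε.le]
  gcongr

theorem eventually_disjoint_regions {z : Fin M → EuclideanSpace ℝ (Fin d)}
    (hz : Function.Injective z) {B : Fin M → Set (EuclideanSpace ℝ (Fin d))} {R : ℝ}
    (hB : ∀ m, B m ⊆ Metric.closedBall 0 R) :
    ∀ᶠ ε : ℝ in 𝓝[>] 0,
      Pairwise fun i j => Disjoint (region (z i) (B i) ε) (region (z j) (B j) ε) := by
  have h : ∀ i j, i ≠ j → ∀ᶠ ε : ℝ in 𝓝[>] 0, ε * R + ε * R < dist (z i) (z j) := by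
    intro i j hij
    have ht : Tendsto (fun ε : ℝ => ε * R + ε * R) (𝓝 0) (𝓝 0) := by
      have : Continuous fun ε : ℝ => ε * R + ε * R := by fun_prop
      simpa using this.tendsto 0
    exact (ht.mono_left nhdsWithin_le_nhds).eventually_lt_const (dist_pos.2 (hz.ne hij))
  simp only [Pairwise, eventually_all]
  intro i j hij
  filter_upwards [h i j hij, self_mem_nhdsWithin] with ε hε hε0
  exact (Metric.closedBall_disjoint_closedBall hε).mono
    (region_subset_closedBall (hB i) hε0) (region_subset_closedBall (hB j) hε0)

theorem norm_sq_le_of_bound_on {G : L2Vec D} {E : Set (EuclideanSpace ℝ (Fin d))} {K : ℝ}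
    (hE : MeasurableSet E) (hfin : volume E ≠ ⊤)
    (hG : ∀ᵐ x ∂volume.restrict (D : Set (EuclideanSpace ℝ (Fin d))),
      ‖G x‖ ≤ E.indicator (fun _ => K) x) :
    ‖G‖ ^ 2 ≤ K ^ 2 * volume.real E := by
  have hfin' : volume.restrict (D : Set (EuclideanSpace ℝ (Fin d))) E ≠ ⊤ :=
    ((Measure.restrict_apply_le _ E).trans_lt hfin.lt_top).ne
  rw [norm_sq_L2Vec]
  calc ∫ x in (D : Set (EuclideanSpace ℝ (Fin d))), ‖G x‖ ^ 2
      ≤ ∫ x in (D : Set (EuclideanSpace ℝ (Fin d))), E.indicator (fun _ => K ^ 2) x := by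
        refine integral_mono_ae (integrable_norm_sq G)
          ((integrable_indicator_iff hE).2 (integrableOn_const hfin')) ?_
        filter_upwards [hG] with x hx
        by_cases hxE : x ∈ E
        · rw [Set.indicator_of_mem hxE] at hx ⊢
          exact pow_le_pow_left₀ (norm_nonneg _) hx 2
        · rw [Set.indicator_of_notMem hxE] at hx ⊢
          rw [le_antisymm hx (norm_nonneg _)]
          simp
    _ = K ^ 2 * (volume.restrict (D : Set (EuclideanSpace ℝ (Fin d)))).real E := by
        rw [integral_indicator_const _ hE, smul_eq_mul, mul_comm]
    _ ≤ K ^ 2 * volume.real E := by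
        refine mul_le_mul_of_nonneg_left ?_ (sq_nonneg _)
        exact ENNReal.toReal_mono hfin (Measure.restrict_apply_le _ E)

theorem volume_real_iUnion_closedBall_le (z : Fin M → EuclideanSpace ℝ (Fin d)) {r : ℝ}
    (hr : 0 ≤ r) :
    volume.real (⋃ m, Metric.closedBall (z m) r) ≤
      M * (r ^ d * volume.real (Metric.ball (0 : EuclideanSpace ℝ (Fin d)) 1)) := by
  refine (measureReal_iUnion_fintype_le _).trans (le_of_eq ?_)
  simp [Measure.addHaar_real_closedBall _ _ hr]

/-- The defect acts on a smooth field as a perturbation of size `ε^{d/2}`. -/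
theorem exists_norm_coeffMul_sub_le {z : Fin M → EuclideanSpace ℝ (Fin d)}
    (hz : Function.Injective z) (hzD : ∀ m, z m ∈ D)
    {B : Fin M → Set (EuclideanSpace ℝ (Fin d))} (hBm : ∀ m, MeasurableSet (B m))
    (hBb : ∀ m, Bornology.IsBounded (B m)) {u : H1 D} {W : EuclideanSpace ℝ (Fin d) → ℂ}
    (hW : ContDiffOn ℝ ∞ W D)
    (hu : (fn D u : EuclideanSpace ℝ (Fin d) → ℂ)
      =ᵐ[volume.restrict (D : Set (EuclideanSpace ℝ (Fin d)))] W) :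
    ∃ C : ℝ, 0 ≤ C ∧ ∀ᶠ ε : ℝ in 𝓝[>] 0,
      (Pairwise fun i j => Disjoint (region (z i) (B i) ε) (region (z j) (B j) ε)) ∧
      ‖coeffMul D (constCoeff A) (grad D u) - coeffMul D (defectCoeff A Am z B hBm ε) (grad D u)‖
        ≤ C * ε ^ ((d : ℝ) / 2) := by
  obtain ⟨R, hR0, hR⟩ : ∃ R : ℝ, 0 ≤ R ∧ ∀ m, B m ⊆ Metric.closedBall 0 R := by
    choose ρ hρ using fun m => (hBb m).subset_closedBall 0
    refine ⟨∑ m, |ρ m|, Finset.sum_nonneg fun _ _ => abs_nonneg _, fun m => (hρ m).trans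
      (Metric.closedBall_subset_closedBall ((le_abs_self _).trans ?_))⟩
    exact Finset.single_le_sum (f := fun m => |ρ m|) (fun _ _ => abs_nonneg _)
      (Finset.mem_univ m)
  choose r hr K hK using fun m => exists_bound_grad_near hW hu (hzD m)
  -- `L` bounds `|(A − A_m)∇w|` near every defect at once. `V` below is chosen so that balls of
  -- radius `εR` about the `z_m` have total volume at most `V ε^d`.
  set L : ℝ := ∑ m, (‖matAct A‖ + ‖matAct (Am m)‖) * |K m| with hL
  have hL0 : 0 ≤ L := Finset.sum_nonneg fun _ _ => by positivity
  set V : ℝ := M * (R ^ d * volume.real (Metric.ball (0 : EuclideanSpace ℝ (Fin d)) 1)) with hV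
  have hV0 : 0 ≤ V := by positivity
  -- For such `ε` each defect lies in the ball where the gradient bound is known.
  have hsmall : ∀ᶠ ε : ℝ in 𝓝[>] 0, ∀ m, ε * R < r m := by
    refine eventually_all.2 fun m => ?_
    have ht : Tendsto (fun ε : ℝ => ε * R) (𝓝 0) (𝓝 0) := by
      have : Continuous fun ε : ℝ => ε * R := by fun_prop
      simpa using this.tendsto 0
    exact (ht.mono_left nhdsWithin_le_nhds).eventually_lt_const (hr m)
  refine ⟨L * √V, by positivity, ?_⟩
  filter_upwards [hsmall, eventually_disjoint_regions hz hR, self_mem_nhdsWithin]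
    with ε hε hdisj hε0
  have hε0 : 0 < ε := hε0
  refine ⟨hdisj, ?_⟩
  have hvol := volume_real_iUnion_closedBall_le z (mul_nonneg hε0.le hR0)
  have hbound := norm_sq_le_of_bound_on (D := D) (K := L)
    (G := coeffMul D (constCoeff A) (grad D u) - coeffMul D (defectCoeff A Am z B hBm ε) (grad D u))
    (E := ⋃ m, Metric.closedBall (z m) (ε * R))
    (MeasurableSet.iUnion fun m => Metric.isClosed_closedBall.measurableSet)
    ((measure_iUnion_fintype_le _ _).trans_lt
      (ENNReal.sum_lt_top.2 fun m _ => measure_closedBall_lt_top)).ne ?_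
  · refine le_of_sq_le_sq (hbound.trans ?_) (by positivity)
    have hpow : (ε ^ ((d : ℝ) / 2)) ^ 2 = ε ^ d := by
      rw [← Real.rpow_natCast, ← Real.rpow_mul hε0.le]
      norm_num
    rw [mul_pow, mul_pow, Real.sq_sqrt hV0, hpow, mul_assoc]
    refine mul_le_mul_of_nonneg_left (hvol.trans (le_of_eq ?_)) (sq_nonneg _)
    rw [hV, mul_pow]
    ring
  · filter_upwards [coeffMul_ae D (constCoeff A) (grad D u),
      coeffMul_ae D (defectCoeff A Am z B hBm ε) (grad D u),
      Lp.coeFn_sub (coeffMul D (constCoeff A) (grad D u))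
        (coeffMul D (defectCoeff A Am z B hBm ε) (grad D u)), ae_all_iff.2 hK]
      with x h1 h2 h3 h4
    rw [h3, Pi.sub_apply, h1, h2]
    by_cases hx : ∃ m, x ∈ region (z m) (B m) ε
    · obtain ⟨m, hm⟩ := hx
      have hball := region_subset_closedBall (hR m) hε0 hm
      rw [Set.indicator_of_mem (Set.mem_iUnion.2 ⟨m, hball⟩),
        defectCoeff_of_mem A Am z B hBm ε hdisj m hm]
      have hg : ‖grad D u x‖ ≤ |K m| :=
        (h4 m (Metric.closedBall_subset_closedBall (hε m).le hball)).trans (le_abs_self _)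
      calc ‖matAct A (grad D u x) - matAct (Am m) (grad D u x)‖
          ≤ ‖matAct A‖ * ‖grad D u x‖ + ‖matAct (Am m)‖ * ‖grad D u x‖ :=
            (norm_sub_le _ _).trans
              (add_le_add (ContinuousLinearMap.le_opNorm _ _) (ContinuousLinearMap.le_opNorm _ _))
        _ = (‖matAct A‖ + ‖matAct (Am m)‖) * ‖grad D u x‖ := by ring
        _ ≤ (‖matAct A‖ + ‖matAct (Am m)‖) * |K m| := by gcongr
        _ ≤ L := Finset.single_le_sum
            (f := fun m => (‖matAct A‖ + ‖matAct (Am m)‖) * |K m|)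
            (fun _ _ => by positivity) (Finset.mem_univ m)
    · rw [defectCoeff_of_notMem A Am z B hBm ε fun m hm => hx ⟨m, hm⟩]
      simpa [constCoeff] using Set.indicator_nonneg (fun _ _ => hL0) x

/-- The difference is tested against itself: the `γ` and `v` terms cancel, leaving only the change
of coefficient acting on `∇w`. -/
theorem norm_op_sub_op_le (a b : Coeff d) (γ : ℝ) (U : X D) :
    ‖op D a γ U - op D b γ U‖ ≤
      ‖coeffMul D a (grad D (wPart D U)) - coeffMul D b (grad D (wPart D U))‖ := by
  set Y := op D a γ U - op D b γ U with hY
  set H := coeffMul D a (grad D (wPart D U)) - coeffMul D b (grad D (wPart D U)) with hH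
  rcases (norm_nonneg Y).eq_or_lt with h0 | h0
  · rw [← h0]
    exact norm_nonneg _
  have h1 : ⟪Y, Y⟫_ℂ = ⟪grad D (wPart D Y), H⟫_ℂ := by
    conv_lhs => rw [hY]
    rw [← hY, inner_sub_right, inner_op, inner_op, form_eq, form_eq, hH, inner_sub_right]
    ring
  have h2 : ‖Y‖ * ‖Y‖ ≤ ‖Y‖ * ‖H‖ := by
    calc ‖Y‖ * ‖Y‖ = ‖⟪Y, Y⟫_ℂ‖ := by
          rw [inner_self_eq_norm_sq_to_K]
          simp [sq]
      _ ≤ ‖grad D (wPart D Y)‖ * ‖H‖ := by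
          rw [h1]
          exact norm_inner_le_norm _ _
      _ ≤ ‖Y‖ * ‖H‖ :=
          mul_le_mul_of_nonneg_right ((norm_grad_le _).trans (norm_wPart_le _)) (norm_nonneg _)
  exact le_of_mul_le_mul_left h2 h0

end Estimates

end TransmissionDefect

end

/-! ### Invertibility and the convergence rate -/

theorem mainTheorem11 (d : ℕ) (hd : d = 2 ∨ d = 3)
    (D : TopologicalSpace.Opens (EuclideanSpace ℝ (Fin d)))
    (hD : Bornology.IsBounded (D : Set (EuclideanSpace ℝ (Fin d))))
    (M : ℕ)
    (A : Matrix (Fin d) (Fin d) ℝ) (hA : A.IsSymm)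
    (Am : Fin M → Matrix (Fin d) (Fin d) ℝ) (hAm : ∀ m, (Am m).IsSymm)
    (z : Fin M → EuclideanSpace ℝ (Fin d)) (hz : Function.Injective z) (hzD : ∀ m, z m ∈ D)
    (B : Fin M → Set (EuclideanSpace ℝ (Fin d)))
    (hBmeas : ∀ m, MeasurableSet (B m)) (hBbdd : ∀ m, Bornology.IsBounded (B m))
    (γ : ℝ)
    (hγ : (1 < TransmissionDefect.quadMin A ∧ (∀ m, 1 < TransmissionDefect.quadMin (Am m)) ∧
            γ = TransmissionDefect.quadMin A) ∨
          (0 < TransmissionDefect.quadMin A ∧ (∀ m, 0 < TransmissionDefect.quadMin (Am m)) ∧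
            TransmissionDefect.quadMax A < 1 ∧ (∀ m, TransmissionDefect.quadMax (Am m) < 1) ∧
            γ = TransmissionDefect.quadMax A)) :
    -- the operators `𝐀₀` and `𝐀_ε` are invertible
    (TransmissionDefect.op D (TransmissionDefect.constCoeff A) γ).IsInvertible ∧
    (∀ ε : ℝ, 0 < ε →
      (Pairwise fun i j => Disjoint (TransmissionDefect.region (z i) (B i) ε)
        (TransmissionDefect.region (z j) (B j) ε)) →
      (TransmissionDefect.op D
        (TransmissionDefect.defectCoeff A Am z B hBmeas ε) γ).IsInvertible) ∧
    -- the estimate for `(w, v) = 𝐀₀⁻¹ F` and `(w_ε, v_ε) = 𝐀_ε⁻¹ F`, where `F = (f, g)`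
    ∀ (F U : TransmissionDefect.X D) (Uε : ℝ → TransmissionDefect.X D),
      U = (TransmissionDefect.op D (TransmissionDefect.constCoeff A) γ).inverse F →
      (∀ ε : ℝ, 0 < ε → Uε ε = (TransmissionDefect.op D
        (TransmissionDefect.defectCoeff A Am z B hBmeas ε) γ).inverse F) →
      (∃ W : EuclideanSpace ℝ (Fin d) → ℂ, ContDiffOn ℝ ∞ W D ∧
        (TransmissionDefect.fn D (TransmissionDefect.wPart D U) : EuclideanSpace ℝ (Fin d) → ℂ)
          =ᵐ[volume.restrict (D : Set (EuclideanSpace ℝ (Fin d)))] W) →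
      (fun ε : ℝ =>
          ‖TransmissionDefect.wPart D (Uε ε) - TransmissionDefect.wPart D U‖
            + ‖TransmissionDefect.vPart D (Uε ε) - TransmissionDefect.vPart D U‖)
        =O[𝓝[>] 0] fun ε : ℝ => ε ^ ((d : ℝ) / 2) := by
  have hd0 : 0 < d := by omega
  obtain ⟨c, hc, hbound⟩ := TransmissionDefect.exists_uniform_bound (D := D) hd0 hA hAm hγ
  have hval0 : ∀ x, (TransmissionDefect.constCoeff A).toFun x = A ∨
      ∃ m, (TransmissionDefect.constCoeff A).toFun x = Am m := fun _ => Or.inl rfl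
  have hinv0 := TransmissionDefect.op_isInvertible hA hAm hc hval0 (hbound _ hval0)
  refine ⟨hinv0, fun ε _ hdisj => ?_, ?_⟩
  · have hval := TransmissionDefect.defectCoeff_values (A := A) (Am := Am) hBmeas hdisj
    exact TransmissionDefect.op_isInvertible hA hAm hc hval (hbound _ hval)
  rintro F U Uε hU hUε ⟨W, hW, hWU⟩
  obtain ⟨C, hC, hdef⟩ := TransmissionDefect.exists_norm_coeffMul_sub_le (A := A) (Am := Am)
    hz hzD hBmeas hBbdd hW hWU
  -- Each of the two components of `U_ε − U` contributes at most `(C/c) ε^{d/2}`.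
  refine Asymptotics.IsBigO.of_bound (2 * (C / c)) ?_
  -- Only `ε` with disjoint defects matter here; for them `inverse` is a genuine inverse and not its
  -- default value.
  filter_upwards [hdef, self_mem_nhdsWithin] with ε hε hε0
  obtain ⟨hdisj, hnorm⟩ := hε
  have hε0 : 0 < ε := hε0
  have hval := TransmissionDefect.defectCoeff_values (A := A) (Am := Am) hBmeas hdisj
  have hinv := TransmissionDefect.op_isInvertible hA hAm hc hval (hbound _ hval)
  -- Both problems have the same right side `F`, so the error solves the perturbed problem with the
  -- residual `(𝐀₀ − 𝐀_ε)U`.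
  have h1 : TransmissionDefect.op D (TransmissionDefect.defectCoeff A Am z B hBmeas ε) γ
      (Uε ε - U) = TransmissionDefect.op D (TransmissionDefect.constCoeff A) γ U -
        TransmissionDefect.op D (TransmissionDefect.defectCoeff A Am z B hBmeas ε) γ U := by
    have hF : TransmissionDefect.op D (TransmissionDefect.constCoeff A) γ U = F := by
      rw [hU, hinv0.self_apply_inverse]
    rw [map_sub, hUε ε hε0, hinv.self_apply_inverse, hF]
  have h2 : c * ‖Uε ε - U‖ ≤ C * ε ^ ((d : ℝ) / 2) := by
    refine (hbound _ hval _).trans ?_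
    rw [h1]
    exact (TransmissionDefect.norm_op_sub_op_le _ _ γ U).trans hnorm
  have h3 : ‖Uε ε - U‖ ≤ C / c * ε ^ ((d : ℝ) / 2) := by
    rw [div_mul_eq_mul_div, le_div_iff₀ hc, mul_comm]
    exact h2
  have hw := TransmissionDefect.norm_wPart_le (Uε ε - U)
  have hv := TransmissionDefect.norm_vPart_le (Uε ε - U)
  rw [map_sub] at hw hv
  rw [Real.norm_of_nonneg (by positivity), Real.norm_of_nonneg (by positivity)]
  linarith
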